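/- An $r$-graph is a family of $r$-element subsets (edges) of a finite vertex set; it is $F$-free if it contains no copy of the $r$-graph $F$, and $\mathrm{ex}_r(n,F)$ is the maximum number of edges of an $F$-free $r$-graph on $n$ vertices. For a bipartite graph $T$ with parts $\{u_1,\dots,u_s\}$ and $\{v_1,\dots,v_t\}$, take pairwise disjoint sets $U_1,\dots,U_s$ of size $a$ and $V_1,\dots,V_t$ of size $b$; the $(a,b)$-blowup of $T$ is the $(a+b)$-graph $T(a,b)=\{U_i\cup V_j : u_iv_j\in E(T)\}$. Theorem. Let $r\ge 3$, $s,t\ge 2$, $a+b=r$ and $b<a<r$. Let $T$ be a tree with parts $\{u_1,\dots,u_s\}$ and $\{v_1,\dots,v_t\}$, and let $\mathcal{T}=T(a,b)$ be its $(a,b)$-blowup. Then, as $n\to\infty$ with $T,a,b$ fixed, every $\mathcal{T}$-free $n$-vertex $r$-graph $H$ satisfies $$|H|\le (t-1)\binom{n}{r-1}+o(n^{r-1}).$$ If $t\le s$, this is asymptotically sharp, that is, $$\mathrm{ex}_r(n,\mathcal{T})=(t-1)\binom{n}{r-1}+o(n^{r-1}),$$ and the lower bound is attained by the crosscut construction: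 for every $n$, the $r$-graph $\Psi^1_{t-1}(n,r)=\{E\subseteq\{1,\dots,n\} : |E|=r,\ |E\cap\{1,\dots,t-1\}|=1\}$ is $\mathcal{T}$-free, and $|\Psi^1_{t-1}(n,r)|=(t-1)\binom{n}{r-1}+o(n^{r-1})$. -/

import Mathlib

open Filter Asymptotics

namespace HypergraphBlowup

/-- A hypergraph on the vertex set `V` is identified with its finite family of edges.
It is an `r`-graph if every edge has exactly `r` elements. -/
def IsUniform {V : Type} (r : ℕ) (H : Finset (Finset V)) : Prop :=
  ∀ e ∈ H, e.card = r

/-- `H` contains a copy of `F`: some injection of the vertex set of `F` into the vertex set of `H`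
sends every edge of `F` to an edge of `H`. -/
def ContainsCopy {W V : Type} (F : Finset (Finset W)) (H : Finset (Finset V)) : Prop :=
  ∃ φ : W ↪ V, ∀ e ∈ F, e.map φ ∈ H

/-- `H` is `F`-free. -/
def IsFree {W V : Type} (F : Finset (Finset W)) (H : Finset (Finset V)) : Prop :=
  ¬ ContainsCopy F H

open Classical in
/-- The Turán number `ex_r(n, F)`: the maximum number of edges of an `F`-free `r`-graph on `n`
vertices. -/
noncomputable def ex {W : Type} (r n : ℕ) (F : Finset (Finset W)) : ℕ :=
  (Finset.univ.filter fun H : Finset (Finset (Fin n)) => IsUniform r H ∧ IsFree F H).sup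
    Finset.card

/-- The vertex set of the `(a,b)`-blowup of a bipartite graph with parts of sizes `s` and `t`:
each of the `s` vertices of the first part is replaced by `a` new vertices, and each of the `t`
vertices of the second part by `b` new vertices. -/
abbrev BlowupVertex (s t a b : ℕ) : Type := (Fin s × Fin a) ⊕ (Fin t × Fin b)

/-- The `a`-set `U_i` that replaces the vertex `u_i`. -/
def blockU {s a : ℕ} (t b : ℕ) (i : Fin s) : Finset (BlowupVertex s t a b) :=
  Finset.univ.image fun k : Fin a => Sum.inl (i, k)

/-- The `b`-set `V_j` that replaces the vertex `v_j`. -/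
def blockV {t b : ℕ} (s a : ℕ) (j : Fin t) : Finset (BlowupVertex s t a b) :=
  Finset.univ.image fun k : Fin b => Sum.inr (j, k)

open Classical in
/-- The `(a,b)`-blowup `{U_i ∪ V_j : u_i v_j ∈ E(T)}` of a bipartite graph `T` with parts
`{u_1, …, u_s}` (the left summand) and `{v_1, …, v_t}` (the right summand). -/
noncomputable def blowup {s t : ℕ} (T : SimpleGraph (Fin s ⊕ Fin t)) (a b : ℕ) :
    Finset (Finset (BlowupVertex s t a b)) :=
  Finset.univ.filter fun e =>
    ∃ (i : Fin s) (j : Fin t), T.Adj (Sum.inl i) (Sum.inr j) ∧ e = blockU t b i ∪ blockV s a j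

/-- The crosscut construction `Ψ¹_c(n, r)`: all `r`-subsets of the `n`-element vertex set that meet
the set of its first `c` vertices in exactly one vertex. -/
def crosscutConstruction (c n r : ℕ) : Finset (Finset (Fin n)) :=
  Finset.univ.filter fun e => e.card = r ∧ (e.filter fun x => x.val < c).card = 1

end HypergraphBlowup

/-!
For the upper bound, the delta-system method is used. By Füredi's theorem (`exists_homogeneous`),
every `r`-graph contains a positive proportion of its edges forming a homogeneous family: an
`r`-partite family in which the colour sets of the pairwise intersections form a family `J`, and
every part of an edge coloured by a member of `J` is the kernel of a large sunflower. If `J` contains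
complementary sets of sizes `a` and `b`, then the blowup of any tree embeds greedily
(`IsHomogeneous.exists_blocks`). As `J` is closed under intersections, it can avoid such pairs only
in three ways (`kernel_types_trichotomy`):

* the family has only `O(n ^ (r - 2))` edges;
* there is a central colour that belongs to every member of `J` of size at least `r - 2`. Then the
  shadows of the links of the central vertices are pairwise disjoint, and the Kruskal–Katona
  theorem shows that all but few edges have their central vertex in a set of bounded size
  (`IsHomogeneous.exists_centers`);
* `b = 1`, and any two edges share at most `r - 2` vertices.

Splitting off homogeneous families until few edges are left shows that, up to `o(n ^ (r - 1))` edges,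
an `r`-graph without the blowup consists of edges meeting a bounded set `W` in exactly one vertex
and, if `b = 1`, of edges off `W` with bounded codegrees of `(r - 1)`-sets (`exists_structure`).

If `b ≥ 2`, all but `O(n ^ (r - 2))` of the `(r - 1)`-sets off `W` are in at most `t - 1` of these
edges: otherwise some `t` vertices of `W` have a dense common link, which contains the
`(a, b - 1)`-blowup, and adding one of the `t` vertices to each block `V_j` gives the
`(a, b)`-blowup (`exists_card_filter_one_le`). If `b = 1`, the vertex set is split at random into `Z`
and its complement such that `W ⊆ Z`. A sufficiently large family of edges with one vertex in `Z`
can be pruned until every remaining `(r - 1)`-set off `Z` lies in `t` edges and every remaining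
vertex of `Z` has large degree, so that the tree embeds greedily with the blocks `V_j` in `Z`
(`card_le_of_card_inter_eq_one`). With probability `1 / r` for a vertex off `W` to lie in `Z`,
averaging (`exists_card_union_le`) loses nothing.

For the lower bound, the first `t - 1` vertices would contain a crosscut of a copy of the blowup. Since
the tree is connected, a crosscut meets all blocks `U_i` or all blocks `V_j`, so it has at
least `min s t` vertices (`isFree_crosscutConstruction`).
-/

namespace HypergraphBlowup

/-! ### Trees and greedy embeddings of their blowups -/

/-- A tree can be built up from a root by adding one vertex at a time, each new vertex having
exactly one neighbour among the vertices already present. -/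
theorem tree_induction {τ : Type*} [Fintype τ] [DecidableEq τ] {T : SimpleGraph τ}
    (hT : T.IsTree) (root : τ) {motive : Finset τ → Prop} (base : motive {root})
    (step : ∀ (P : Finset τ) (p q : τ), p ∈ P → q ∉ P → T.Adj p q →
      (∀ p' ∈ P, T.Adj p' q → p' = p) → motive P → motive (insert q P)) :
    motive Finset.univ := by
  classical
  -- every vertex of a partial tree is joined to the root by a path inside the partial tree
  have key : ∀ k ≤ Fintype.card τ - 1, ∃ P : Finset τ, root ∈ P ∧ P.card = k + 1 ∧ motive P ∧
      ∀ u ∈ P, ∃ w : T.Walk root u, w.IsPath ∧ ∀ x ∈ w.support, x ∈ P := by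
    intro k
    induction k with
    | zero =>
      intro _
      refine ⟨{root}, by simp, by simp, base, ?_⟩
      intro u hu
      obtain rfl := Finset.mem_singleton.1 hu
      exact ⟨.nil, by simp, by simp⟩
    | succ k ih =>
      intro hk
      obtain ⟨P, hr, hcard, hm, hP⟩ := ih (by omega)
      obtain ⟨v, hv⟩ : ∃ v, v ∉ P := by
        by_contra! h
        have : P = Finset.univ := Finset.eq_univ_iff_forall.2 h
        rw [this, Finset.card_univ] at hcard
        omega
      obtain ⟨w⟩ := hT.connected root v
      obtain ⟨d, -, hp, hq⟩ := w.exists_boundary_dart (P : Set τ) (by simpa using hr)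
        (by simpa using hv)
      have hp' : d.fst ∈ P := by simpa using hp
      have hq' : d.snd ∉ P := by simpa using hq
      obtain ⟨w₁, hw₁, hs₁⟩ := hP _ hp'
      have hpath : (w₁.concat d.adj).IsPath := hw₁.concat (fun h => hq' (hs₁ _ h)) d.adj
      refine ⟨insert d.snd P, by simp [hr], by rw [Finset.card_insert_of_notMem hq', hcard],
        step P d.fst d.snd hp' hq' d.adj ?_ hm, ?_⟩
      · intro p' hp'' hadj
        obtain ⟨w₂, hw₂, hs₂⟩ := hP _ hp''
        have hpath₂ : (w₂.concat hadj).IsPath := hw₂.concat (fun h => hq' (hs₂ _ h)) hadj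
        have := (hT.isAcyclic.subsingleton_path root d.snd).elim ⟨_, hpath₂⟩ ⟨_, hpath⟩
        obtain ⟨h, -⟩ := SimpleGraph.Walk.concat_inj (Subtype.ext_iff.1 this)
        exact h
      · intro u hu
        rcases Finset.mem_insert.1 hu with rfl | hu
        · refine ⟨_, hpath, ?_⟩
          intro x hx
          rw [SimpleGraph.Walk.support_concat, List.mem_append,
            List.mem_singleton] at hx
          rcases hx with hx | rfl
          · exact Finset.mem_insert_of_mem (hs₁ _ hx)
          · exact Finset.mem_insert_self _ _
        · obtain ⟨w, hw, hs⟩ := hP u hu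
          exact ⟨w, hw, fun x hx => Finset.mem_insert_of_mem (hs x hx)⟩
  obtain ⟨P, -, hcard, hm, -⟩ := key _ le_rfl
  have hpos : 0 < Fintype.card τ := Fintype.card_pos_iff.2 ⟨root⟩
  have : P = Finset.univ := (Finset.card_eq_iff_eq_univ P).1 (by omega)
  rwa [this] at hm

/-- The greedy embedding principle. Blocks for the first part of the tree are taken from `𝒜`,
blocks for the second part from `ℬ`, and `R` says which pairs of blocks may represent an edge.
If every block can be extended to a good pair while avoiding as many other blocks as the tree
can have used before, then the whole tree can be represented by pairwise disjoint blocks. -/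
theorem exists_blocks {s t : ℕ} {T : SimpleGraph (Fin s ⊕ Fin t)} (hT : T.IsTree)
    (hbip : T ≤ completeBipartiteGraph (Fin s) (Fin t)) (hs : 0 < s)
    {V : Type*} [DecidableEq V] (𝒜 ℬ : Set (Finset V)) (R : Finset V → Finset V → Prop)
    (hne : 𝒜.Nonempty)
    (hA : ∀ A ∈ 𝒜, ∀ 𝒰 𝒱 : Finset (Finset V), (∀ C ∈ 𝒰, C ∈ 𝒜) → (∀ C ∈ 𝒱, C ∈ ℬ) →
      𝒰.card ≤ s → 𝒱.card < t → ∃ B ∈ ℬ, R A B ∧ (∀ C ∈ 𝒰, Disjoint C B) ∧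
        ∀ C ∈ 𝒱, Disjoint C B)
    (hB : ∀ B ∈ ℬ, ∀ 𝒰 𝒱 : Finset (Finset V), (∀ C ∈ 𝒰, C ∈ 𝒜) → (∀ C ∈ 𝒱, C ∈ ℬ) →
      𝒰.card < s → 𝒱.card ≤ t → ∃ A ∈ 𝒜, R A B ∧ (∀ C ∈ 𝒰, Disjoint C A) ∧
        ∀ C ∈ 𝒱, Disjoint C A) :
    ∃ (f : Fin s → Finset V) (g : Fin t → Finset V), (∀ i, f i ∈ 𝒜) ∧ (∀ j, g j ∈ ℬ) ∧
      (∀ i i', i ≠ i' → Disjoint (f i) (f i')) ∧ (∀ j j', j ≠ j' → Disjoint (g j) (g j')) ∧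
      (∀ i j, Disjoint (f i) (g j)) ∧
      ∀ i j, T.Adj (Sum.inl i) (Sum.inr j) → R (f i) (g j) := by
  classical
  obtain ⟨A₀, hA₀⟩ := hne
  let motive : Finset (Fin s ⊕ Fin t) → Prop := fun P =>
    ∃ (f : Fin s → Finset V) (g : Fin t → Finset V), (∀ i, Sum.inl i ∈ P → f i ∈ 𝒜) ∧
      (∀ j, Sum.inr j ∈ P → g j ∈ ℬ) ∧
      (∀ i i', Sum.inl i ∈ P → Sum.inl i' ∈ P → i ≠ i' → Disjoint (f i) (f i')) ∧
      (∀ j j', Sum.inr j ∈ P → Sum.inr j' ∈ P → j ≠ j' → Disjoint (g j) (g j')) ∧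
      (∀ i j, Sum.inl i ∈ P → Sum.inr j ∈ P → Disjoint (f i) (g j)) ∧
      ∀ i j, Sum.inl i ∈ P → Sum.inr j ∈ P → T.Adj (Sum.inl i) (Sum.inr j) → R (f i) (g j)
  have hfin : motive Finset.univ := by
    refine tree_induction hT (Sum.inl ⟨0, hs⟩) (motive := motive) ?_ ?_
    · exact ⟨fun _ => A₀, fun _ => ∅, by simp [hA₀], by simp, by simp +contextual, by simp,
        by simp, by simp⟩
    · rintro P p q hp hq hadj huniq ⟨f, g, hf, hg, hff, hgg, hfg, hR⟩
      let IU : Finset (Fin s) := Finset.univ.filter fun i => Sum.inl i ∈ P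
      let JV : Finset (Fin t) := Finset.univ.filter fun j => Sum.inr j ∈ P
      have hU : ∀ C ∈ IU.image f, C ∈ 𝒜 := by
        intro C hC
        obtain ⟨i, hi, rfl⟩ := Finset.mem_image.1 hC
        exact hf i (by simpa [IU] using hi)
      have hV : ∀ C ∈ JV.image g, C ∈ ℬ := by
        intro C hC
        obtain ⟨i, hi, rfl⟩ := Finset.mem_image.1 hC
        exact hg i (by simpa [JV] using hi)
      have memU : ∀ i, Sum.inl i ∈ P → f i ∈ IU.image f := fun i hi =>
        Finset.mem_image_of_mem f (by simpa [IU] using hi)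
      have memV : ∀ j, Sum.inr j ∈ P → g j ∈ JV.image g := fun j hj =>
        Finset.mem_image_of_mem g (by simpa [JV] using hj)
      have cU : (IU.image f).card ≤ s := by
        refine Finset.card_image_le.trans ?_
        simpa using Finset.card_le_univ IU
      have cV : (JV.image g).card ≤ t := by
        refine Finset.card_image_le.trans ?_
        simpa using Finset.card_le_univ JV
      rcases q with i₀ | j₀
      · rcases p with i₁ | j₁
        · simpa using hbip hadj
        have cU' : (IU.image f).card < s := by
          refine Finset.card_image_le.trans_lt ?_
          have : IU.card < (Finset.univ : Finset (Fin s)).card :=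
            Finset.card_lt_card (Finset.ssubset_univ_iff.2 fun h => hq (by
              have : i₀ ∈ IU := h ▸ Finset.mem_univ _
              simpa [IU] using this))
          simpa using this
        obtain ⟨A, hA𝒜, hRA, hdU, hdV⟩ := hB _ (hg j₁ hp) _ _ hU hV cU' cV
        have ne₀ : ∀ i, Sum.inl i ∈ P → i ≠ i₀ := fun i hi h => hq (h ▸ hi)
        refine ⟨Function.update f i₀ A, g, ?_, ?_, ?_, ?_, ?_, ?_⟩
        · intro i hi
          rcases eq_or_ne i i₀ with rfl | h
          · simpa using hA𝒜
          · simpa [h] using hf i (by simpa [h] using hi)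
        · intro j hj
          exact hg j (by simpa using hj)
        · intro i i' hi hi' hne
          rcases eq_or_ne i i₀ with rfl | h
          · have h' : i' ≠ i := hne.symm
            simpa [h'] using (hdU _ (memU i' (by simpa [h'] using hi'))).symm
          · rcases eq_or_ne i' i₀ with rfl | h'
            · simpa [h] using hdU _ (memU i (by simpa [h] using hi))
            · simpa [h, h'] using hff i i' (by simpa [h] using hi) (by simpa [h'] using hi') hne
        · intro j j' hj hj' hne
          exact hgg j j' (by simpa using hj) (by simpa using hj') hne
        · intro i j hi hj
          rcases eq_or_ne i i₀ with rfl | h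
          · simpa using (hdV _ (memV j (by simpa using hj))).symm
          · simpa [h] using hfg i j (by simpa [h] using hi) (by simpa using hj)
        · intro i j hi hj hij
          rcases eq_or_ne i i₀ with rfl | h
          · have : Sum.inr j = (Sum.inr j₁ : Fin s ⊕ Fin t) :=
              huniq _ (by simpa using hj) hij.symm
            obtain rfl : j = j₁ := by simpa using this
            simpa using hRA
          · simpa [h] using hR i j (by simpa [h] using hi) (by simpa using hj) hij
      · rcases p with i₁ | j₁
        swap
        · simpa using hbip hadj
        have cV' : (JV.image g).card < t := by
          refine Finset.card_image_le.trans_lt ?_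
          have : JV.card < (Finset.univ : Finset (Fin t)).card :=
            Finset.card_lt_card (Finset.ssubset_univ_iff.2 fun h => hq (by
              have : j₀ ∈ JV := h ▸ Finset.mem_univ _
              simpa [JV] using this))
          simpa using this
        obtain ⟨B, hBℬ, hRB, hdU, hdV⟩ := hA _ (hf i₁ hp) _ _ hU hV cU cV'
        refine ⟨f, Function.update g j₀ B, ?_, ?_, ?_, ?_, ?_, ?_⟩
        · intro i hi
          exact hf i (by simpa using hi)
        · intro j hj
          rcases eq_or_ne j j₀ with rfl | h
          · simpa using hBℬ
          · simpa [h] using hg j (by simpa [h] using hj)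
        · intro i i' hi hi' hne
          exact hff i i' (by simpa using hi) (by simpa using hi') hne
        · intro j j' hj hj' hne
          rcases eq_or_ne j j₀ with rfl | h
          · have h' : j' ≠ j := hne.symm
            simpa [h'] using (hdV _ (memV j' (by simpa [h'] using hj'))).symm
          · rcases eq_or_ne j' j₀ with rfl | h'
            · simpa [h] using hdV _ (memV j (by simpa [h] using hj))
            · simpa [h, h'] using hgg j j' (by simpa [h] using hj) (by simpa [h'] using hj') hne
        · intro i j hi hj
          rcases eq_or_ne j j₀ with rfl | h
          · simpa using hdU _ (memU i (by simpa using hi))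
          · simpa [h] using hfg i j (by simpa using hi) (by simpa [h] using hj)
        · intro i j hi hj hij
          rcases eq_or_ne j j₀ with rfl | h
          · have : Sum.inl i = (Sum.inl i₁ : Fin s ⊕ Fin t) :=
              huniq _ (by simpa using hi) hij
            obtain rfl : i = i₁ := by simpa using this
            simpa using hRB
          · simpa [h] using hR i j (by simpa using hi) (by simpa [h] using hj) hij
  obtain ⟨f, g, h1, h2, h3, h4, h5, h6⟩ := hfin
  exact ⟨f, g, fun i => h1 i (by simp), fun j => h2 j (by simp), fun i i' => h3 i i' (by simp)
    (by simp), fun j j' => h4 j j' (by simp) (by simp), fun i j => h5 i j (by simp) (by simp),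
    fun i j => h6 i j (by simp) (by simp)⟩

/-- Pairwise disjoint blocks of the right sizes span a copy of the blowup as soon as their unions
along the edges of the tree are edges of the hypergraph. -/
theorem containsCopy_of_blocks {s t a b : ℕ} {T : SimpleGraph (Fin s ⊕ Fin t)}
    {V : Type} [DecidableEq V] {H : Finset (Finset V)} (f : Fin s → Finset V)
    (g : Fin t → Finset V)
    (hf : ∀ i, (f i).card = a) (hg : ∀ j, (g j).card = b)
    (hff : ∀ i i', i ≠ i' → Disjoint (f i) (f i')) (hgg : ∀ j j', j ≠ j' → Disjoint (g j) (g j'))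
    (hfg : ∀ i j, Disjoint (f i) (g j))
    (hH : ∀ i j, T.Adj (Sum.inl i) (Sum.inr j) → f i ∪ g j ∈ H) :
    ContainsCopy (blowup T a b) H := by
  classical
  let ef : ∀ i, Fin a ≃ f i := fun i => (Finset.equivFinOfCardEq (hf i)).symm
  let eg : ∀ j, Fin b ≃ g j := fun j => (Finset.equivFinOfCardEq (hg j)).symm
  let φ : BlowupVertex s t a b → V :=
    Sum.elim (fun x => (ef x.1 x.2 : V)) (fun x => (eg x.1 x.2 : V))
  have hφ : Function.Injective φ := by
    rintro (⟨i, k⟩ | ⟨j, k⟩) (⟨i', k'⟩ | ⟨j', k'⟩) h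
    · simp only [φ, Sum.elim_inl] at h
      rcases eq_or_ne i i' with rfl | hne
      · simpa using h
      · exact absurd h (Finset.disjoint_iff_ne.1 (hff i i' hne) _ (ef i k).2 _ (ef i' k').2)
    · simp only [φ, Sum.elim_inl, Sum.elim_inr] at h
      exact absurd h (Finset.disjoint_iff_ne.1 (hfg i j') _ (ef i k).2 _ (eg j' k').2)
    · simp only [φ, Sum.elim_inl, Sum.elim_inr] at h
      exact absurd h.symm (Finset.disjoint_iff_ne.1 (hfg i' j) _ (ef i' k').2 _ (eg j k).2)
    · simp only [φ, Sum.elim_inr] at h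
      rcases eq_or_ne j j' with rfl | hne
      · simpa using h
      · exact absurd h (Finset.disjoint_iff_ne.1 (hgg j j' hne) _ (eg j k).2 _ (eg j' k').2)
  refine ⟨⟨φ, hφ⟩, ?_⟩
  intro e he
  simp only [blowup, Finset.mem_filter, Finset.mem_univ, true_and] at he
  obtain ⟨i, j, hij, rfl⟩ := he
  convert hH i j hij using 1
  ext x
  simp only [Finset.mem_map, Finset.mem_union, blockU, blockV, Finset.mem_image, Finset.mem_univ,
    true_and, Function.Embedding.coeFn_mk]
  constructor
  · rintro ⟨y, ⟨k, rfl⟩ | ⟨k, rfl⟩, rfl⟩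
    · exact Or.inl (ef i k).2
    · exact Or.inr (eg j k).2
  · rintro (hx | hx)
    · exact ⟨_, Or.inl ⟨(ef i).symm ⟨x, hx⟩, rfl⟩, by simp [φ]⟩
    · exact ⟨_, Or.inr ⟨(eg j).symm ⟨x, hx⟩, rfl⟩, by simp [φ]⟩

/-! ### Homogeneous subfamilies -/

/-- The part of `E` that lies in the colour classes belonging to `A`. -/
def part {V : Type} {m : ℕ} (χ : V → Fin m) (E : Finset V) (A : Finset (Fin m)) : Finset V :=
  E.filter fun x => χ x ∈ A

/-- Every colour occurs exactly once on every member of the family. -/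
def IsRainbow {V : Type} {m : ℕ} (χ : V → Fin m) (G : Finset (Finset V)) : Prop :=
  ∀ E ∈ G, Set.BijOn χ (E : Set V) Set.univ

section Part

variable {V : Type} {m : ℕ} {χ : V → Fin m} {E E' : Finset V} {A B : Finset (Fin m)}

theorem mem_part {x : V} : x ∈ part χ E A ↔ x ∈ E ∧ χ x ∈ A := Finset.mem_filter

theorem part_subset : part χ E A ⊆ E := Finset.filter_subset _ _

theorem image_part (hE : Set.BijOn χ (E : Set V) Set.univ) : (part χ E A).image χ = A := by
  ext i
  simp only [Finset.mem_image, mem_part]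
  constructor
  · rintro ⟨x, ⟨-, h⟩, rfl⟩
    exact h
  · intro hi
    obtain ⟨x, hx, rfl⟩ := hE.surjOn (Set.mem_univ i)
    exact ⟨x, ⟨hx, hi⟩, rfl⟩

theorem card_part (hE : Set.BijOn χ (E : Set V) Set.univ) : (part χ E A).card = A.card := by
  rw [← image_part (A := A) hE, Finset.card_image_of_injOn]
  · rw [image_part hE]
  · exact hE.injOn.mono (Finset.coe_subset.2 part_subset)

theorem card_of_bijOn (hE : Set.BijOn χ (E : Set V) Set.univ) : E.card = m := by
  have h := card_part (A := Finset.univ) hE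
  have : part χ E Finset.univ = E := by ext; simp [mem_part]
  simpa [this] using h

theorem part_eq_of_subset (hE : Set.BijOn χ (E : Set V) Set.univ)
    (hE' : Set.BijOn χ (E' : Set V) Set.univ) (h : part χ E A ⊆ E') :
    part χ E' A = part χ E A := by
  symm
  refine Finset.eq_of_subset_of_card_le ?_ (by rw [card_part hE, card_part hE'])
  intro x hx
  exact mem_part.2 ⟨h hx, (mem_part.1 hx).2⟩

variable [DecidableEq V]

theorem inter_eq_part (hE : Set.BijOn χ (E : Set V) Set.univ) :
    E ∩ E' = part χ E ((E ∩ E').image χ) := by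
  ext x
  simp only [Finset.mem_inter, mem_part, Finset.mem_image]
  constructor
  · rintro ⟨h, h'⟩
    exact ⟨h, x, ⟨h, h'⟩, rfl⟩
  · rintro ⟨h, y, ⟨hy, hy'⟩, hxy⟩
    obtain rfl := hE.injOn (by exact_mod_cast hy) (by exact_mod_cast h) hxy
    exact ⟨hy, hy'⟩

theorem part_inter_part : part χ E A ∩ part χ E B = part χ E (A ∩ B) := by
  ext x
  simp only [Finset.mem_inter, mem_part]
  tauto

theorem part_union_part (h : A ∪ B = Finset.univ) : part χ E A ∪ part χ E B = E := by
  ext x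
  have hx : χ x ∈ A ∪ B := h ▸ Finset.mem_univ _
  simp only [Finset.mem_union, mem_part] at hx ⊢
  tauto

theorem sdiff_part_eq (h : A ∪ B = Finset.univ) (hd : Disjoint A B) :
    E \ part χ E A = part χ E B := by
  ext x
  have hx : χ x ∈ A ∪ B := h ▸ Finset.mem_univ _
  have : χ x ∈ A → χ x ∉ B := fun h' => Finset.disjoint_left.1 hd h'
  simp only [Finset.mem_sdiff, Finset.mem_union, mem_part] at hx ⊢
  tauto

end Part

/-- The colour set `A` is a `k`-kernel type of the family `G`: the part of any member of `G`
coloured by `A` extends to members of `G` that avoid any prescribed `k` further vertices. (Up to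
the value of `k`, this says that the part is the kernel of a sunflower with `k` petals.) -/
def IsKernel {V : Type} [DecidableEq V] {m : ℕ} (k : ℕ) (χ : V → Fin m) (G : Finset (Finset V))
    (A : Finset (Fin m)) : Prop :=
  ∀ E ∈ G, ∀ Q : Finset V, Q.card ≤ k →
    ∃ E' ∈ G, part χ E A ⊆ E' ∧ Disjoint (E' \ part χ E A) Q

/-- A homogeneous family, in the sense of the delta-system method: the members are rainbow, the
intersections of its members all have their colour set in `J`, and every colour set in `J` is a
`k`-kernel type. -/
structure IsHomogeneous {V : Type} [DecidableEq V] {m : ℕ} (k : ℕ) (χ : V → Fin m)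
    (J : Finset (Finset (Fin m))) (G : Finset (Finset V)) : Prop where
  rainbow : IsRainbow χ G
  kernel : ∀ A ∈ J, IsKernel k χ G A
  inter_mem : ∀ E ∈ G, ∀ E' ∈ G, (E ∩ E').image χ ∈ J

/-- Deleting, again and again, all edges through a set that is not a kernel leaves a family in
which all colour sets of `U` are kernel types. The deleted edges are sorted by the colour set that
caused the deletion. -/
theorem exists_cleaning {V : Type} [DecidableEq V] {m : ℕ} (k : ℕ) (χ : V → Fin m)
    (U : Finset (Finset (Fin m))) (G : Finset (Finset V)) (hG : IsRainbow χ G) :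
    ∃ (G₀ : Finset (Finset V)) (D : Finset (Fin m) → Finset (Finset V)),
      G₀ ⊆ G ∧ (∀ A, D A ⊆ G) ∧ G ⊆ G₀ ∪ U.biUnion D ∧ (∀ A ∈ U, IsKernel k χ G₀ A) ∧
      ∀ A ∈ U, ∀ E ∈ D A, ∃ Q : Finset V, Q.card ≤ k ∧
        ∀ E' ∈ D A, part χ E A ⊆ E' → ¬ Disjoint (E' \ part χ E A) Q := by
  classical
  induction hn : G.card using Nat.strong_induction_on generalizing G with
  | _ n ih =>
    by_cases hk : ∀ A ∈ U, IsKernel k χ G A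
    · exact ⟨G, fun _ => ∅, subset_rfl, by simp, by simp, hk, by simp⟩
    · simp only [IsKernel] at hk
      push Not at hk
      obtain ⟨A, hA, E, hE, Q, hQ, hbad⟩ := hk
      set X := G.filter fun E' => part χ E A ⊆ E' with hX
      have hEX : E ∈ X := Finset.mem_filter.2 ⟨hE, part_subset⟩
      have hlt : (G \ X).card < n := by
        rw [← hn]
        refine Finset.card_lt_card ⟨Finset.sdiff_subset, fun h => ?_⟩
        exact (Finset.mem_sdiff.1 (h hE)).2 hEX
      obtain ⟨G₀, D, h1, h2, h3, h4, h5⟩ := ih _ hlt (G \ X)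
        (fun E hE => hG E (Finset.sdiff_subset hE)) rfl
      refine ⟨G₀, Function.update D A (D A ∪ X), h1.trans Finset.sdiff_subset, ?_, ?_, h4, ?_⟩
      · intro A'
        rcases eq_or_ne A' A with rfl | h
        · simpa using Finset.union_subset ((h2 _).trans Finset.sdiff_subset)
            (Finset.filter_subset _ _)
        · simpa [h] using (h2 A').trans Finset.sdiff_subset
      · intro F hF
        by_cases hFX : F ∈ X
        · refine Finset.mem_union_right _ (Finset.mem_biUnion.2 ⟨A, hA, ?_⟩)
          simp [hFX]
        · rcases Finset.mem_union.1 (h3 (Finset.mem_sdiff.2 ⟨hF, hFX⟩)) with h | h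
          · exact Finset.mem_union_left _ h
          · obtain ⟨A', hA', hFA'⟩ := Finset.mem_biUnion.1 h
            refine Finset.mem_union_right _ (Finset.mem_biUnion.2 ⟨A', hA', ?_⟩)
            rcases eq_or_ne A' A with rfl | h
            · simp [hFA']
            · simpa [h] using hFA'
      · intro A' hA' F hF
        rcases eq_or_ne A' A with rfl | h
        · simp only [Function.update_self, Finset.mem_union] at hF ⊢
          rcases hF with hF | hF
          · obtain ⟨Q', hQ', hQ''⟩ := h5 _ hA' F hF
            refine ⟨Q', hQ', ?_⟩
            rintro F' (hF' | hF') hsub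
            · exact hQ'' F' hF' hsub
            · exfalso
              have hFG := Finset.mem_sdiff.1 (h2 _ hF)
              have hF'G := Finset.mem_filter.1 hF'
              have e1 := part_eq_of_subset (hG _ hE) (hG _ hF'G.1) hF'G.2
              have e2 := part_eq_of_subset (hG _ hFG.1) (hG _ hF'G.1) hsub
              refine hFG.2 (Finset.mem_filter.2 ⟨hFG.1, ?_⟩)
              rw [← e1, e2]
              exact part_subset
          · have hFG := Finset.mem_filter.1 hF
            rw [part_eq_of_subset (hG _ hE) (hG _ hFG.1) hFG.2]
            refine ⟨Q, hQ, ?_⟩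
            rintro F' (hF' | hF') hsub
            · exact hbad F' (Finset.sdiff_subset (h2 _ hF')) hsub
            · exact hbad F' (Finset.mem_filter.1 hF').1 hsub
        · simp only [Function.update_of_ne h] at hF ⊢
          exact h5 A' hA' F hF

/-- If the sets coloured by `A` have small hitting sets for their petals, a positive proportion of
the family has no two members whose intersection is coloured exactly by `A`. -/
theorem exists_avoiding {V : Type} [DecidableEq V] {m : ℕ} (k : ℕ) (χ : V → Fin m)
    (A : Finset (Fin m)) (D : Finset (Finset V)) (hD : IsRainbow χ D)
    (h : ∀ E ∈ D, ∃ Q : Finset V, Q.card ≤ k ∧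
        ∀ E' ∈ D, part χ E A ⊆ E' → ¬ Disjoint (E' \ part χ E A) Q) :
    ∃ D' ⊆ D, D.card ≤ k * D'.card ∧ ∀ E ∈ D', ∀ E' ∈ D', (E ∩ E').image χ ≠ A := by
  classical
  -- a popular vertex of the hitting set
  have hx : ∀ K ∈ D.image (fun E => part χ E A), ∃ x : V,
      (D.filter fun E => part χ E A = K).card ≤
        k * (D.filter fun E => part χ E A = K ∧ x ∈ E \ K).card := by
    intro K hK
    obtain ⟨E, hE, rfl⟩ := Finset.mem_image.1 hK
    obtain ⟨Q, hQ, hQ'⟩ := h E hE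
    by_contra! hcon
    have hsub : (D.filter fun E' => part χ E' A = part χ E A) ⊆
        Q.biUnion fun x => D.filter fun E' => part χ E' A = part χ E A ∧ x ∈ E' \ part χ E A := by
      intro E' hE'
      obtain ⟨hE'D, he⟩ := Finset.mem_filter.1 hE'
      obtain ⟨x, hx1, hx2⟩ := Finset.not_disjoint_iff.1 (hQ' E' hE'D (he ▸ part_subset))
      exact Finset.mem_biUnion.2 ⟨x, hx2, Finset.mem_filter.2 ⟨hE'D, he, hx1⟩⟩
    have h1 := (Finset.card_le_card hsub).trans Finset.card_biUnion_le
    have hEm : E ∈ D.filter fun E' => part χ E' A = part χ E A := by simp [hE]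
    have hpos := Finset.card_pos.2 ⟨E, hEm⟩
    set N := (D.filter fun E' => part χ E' A = part χ E A).card
    have hQne : Q.Nonempty := by
      by_contra hne
      rw [Finset.not_nonempty_iff_eq_empty.1 hne] at h1
      simp at h1
      omega
    have h2 : k * N < k * N := calc
      k * N ≤ k * ∑ x ∈ Q,
          (D.filter fun E' => part χ E' A = part χ E A ∧ x ∈ E' \ part χ E A).card := by gcongr
      _ = ∑ x ∈ Q,
          k * (D.filter fun E' => part χ E' A = part χ E A ∧ x ∈ E' \ part χ E A).card :=
        Finset.mul_sum _ _ _
      _ < ∑ x ∈ Q, N := Finset.sum_lt_sum_of_nonempty hQne fun x _ => hcon x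
      _ = Q.card * N := by simp
      _ ≤ k * N := by gcongr
    exact lt_irrefl _ h2
  rcases D.eq_empty_or_nonempty with rfl | ⟨E₀, hE₀⟩
  · exact ⟨∅, by simp, by simp, by simp⟩
  obtain ⟨Q₀, -, hQ₀⟩ := h E₀ hE₀
  obtain ⟨x₀, -⟩ := Finset.not_disjoint_iff.1 (hQ₀ E₀ hE₀ part_subset)
  have : Nonempty V := ⟨x₀⟩
  choose! x hx using hx
  refine ⟨D.filter fun E => x (part χ E A) ∈ E \ part χ E A, Finset.filter_subset _ _, ?_, ?_⟩
  · calc D.card = ∑ K ∈ D.image (fun E => part χ E A),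
          (D.filter fun E => part χ E A = K).card :=
        Finset.card_eq_sum_card_image _ _
      _ ≤ ∑ K ∈ D.image (fun E => part χ E A),
          k * (D.filter fun E => part χ E A = K ∧ x K ∈ E \ K).card :=
        Finset.sum_le_sum hx
      _ = k * ∑ K ∈ D.image (fun E => part χ E A),
          ((D.filter fun E => x (part χ E A) ∈ E \ part χ E A).filter
            fun E => part χ E A = K).card := by
        rw [Finset.mul_sum]
        refine Finset.sum_congr rfl fun K _ => ?_
        congr 2
        ext E
        simp only [Finset.mem_filter]
        constructor
        · rintro ⟨h1, rfl, h2⟩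
          exact ⟨⟨h1, h2⟩, rfl⟩
        · rintro ⟨⟨h1, h2⟩, rfl⟩
          exact ⟨h1, rfl, h2⟩
      _ = _ := by
        rw [← Finset.card_eq_sum_card_fiberwise]
        intro E hE
        exact Finset.mem_coe.2 (Finset.mem_image_of_mem _ (Finset.mem_filter.1 hE).1)
  · intro E hE E' hE' heq
    obtain ⟨h1, h2⟩ := Finset.mem_filter.1 hE
    obtain ⟨h1', h2'⟩ := Finset.mem_filter.1 hE'
    have e1 : E ∩ E' = part χ E A := by
      rw [inter_eq_part (hD _ h1), heq]
    have e2 : E' ∩ E = part χ E' A := by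
      rw [inter_eq_part (hD _ h1'), Finset.inter_comm, heq]
    have e3 : part χ E' A = part χ E A := by rw [← e1, ← e2, Finset.inter_comm]
    rw [e3] at h2'
    refine (Finset.mem_sdiff.1 h2).2 ?_
    exact (Finset.ext_iff.1 e1 _).1 <| Finset.mem_inter.2 ⟨(Finset.mem_sdiff.1 h2).1, (Finset.mem_sdiff.1 h2').1⟩

/-- Homogeneous subfamilies of rainbow families. The set `M` collects the colour sets already known
not to occur as intersections; the induction is on the number of the remaining ones. -/
theorem exists_homogeneous_of_rainbow (k m N : ℕ) : ∃ C : ℕ, ∀ (V : Type) [DecidableEq V]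
    (χ : V → Fin m) (M : Finset (Finset (Fin m))) (G : Finset (Finset V)), IsRainbow χ G →
    (∀ A ∈ M, ∀ E ∈ G, ∀ E' ∈ G, (E ∩ E').image χ ≠ A) → Mᶜ.card ≤ N →
    ∃ J, ∃ G' ⊆ G, IsHomogeneous k χ J G' ∧ G.card ≤ C * G'.card := by
  classical
  induction N with
  | zero =>
    refine ⟨0, fun V _ χ M G hG hM hc => ⟨∅, ∅, by simp, ⟨by simp [IsRainbow], by simp, by simp⟩, ?_⟩⟩
    have hMu : M = Finset.univ := by simpa using hc
    rw [Nat.zero_mul, Nat.le_zero, Finset.card_eq_zero, Finset.eq_empty_iff_forall_notMem]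
    intro E hE
    exact hM _ (hMu ▸ Finset.mem_univ _) E hE E hE rfl
  | succ N ih =>
    obtain ⟨C, hC⟩ := ih
    refine ⟨2 + 2 * (2 ^ m * (k * C)), fun V _ χ M G hG hM hc => ?_⟩
    obtain ⟨G₀, D, h1, h2, h3, h4, h5⟩ := exists_cleaning k χ Mᶜ G hG
    by_cases hbig : G.card ≤ 2 * G₀.card
    · refine ⟨Mᶜ, G₀, h1, ⟨fun E hE => hG E (h1 hE), h4, ?_⟩, hbig.trans ?_⟩
      · intro E hE E' hE'
        rw [Finset.mem_compl]
        exact fun hmem => hM _ hmem E (h1 hE) E' (h1 hE') rfl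
      · gcongr
        omega
    · push Not at hbig
      have hcard : G.card ≤ G₀.card + ∑ A ∈ Mᶜ, (D A).card :=
        (Finset.card_le_card h3).trans ((Finset.card_union_le _ _).trans
          (by gcongr; exact Finset.card_biUnion_le))
      obtain ⟨A, hA, hDA⟩ : ∃ A ∈ Mᶜ, G.card ≤ 2 * (2 ^ m * (D A).card) := by
        by_contra! hcon
        have hMc : Mᶜ.card ≤ 2 ^ m := by
          refine (Finset.card_le_univ _).trans ?_
          simp
        have hne : Mᶜ.Nonempty := by
          by_contra hne
          rw [Finset.not_nonempty_iff_eq_empty.1 hne] at hcard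
          simp at hcard
          omega
        have : 2 ^ m * (2 * ∑ A ∈ Mᶜ, (D A).card) < 2 ^ m * G.card := calc
          2 ^ m * (2 * ∑ A ∈ Mᶜ, (D A).card)
              = ∑ A ∈ Mᶜ, 2 * (2 ^ m * (D A).card) := by
            rw [← Finset.mul_sum, ← Finset.mul_sum]
            ring
          _ < ∑ A ∈ Mᶜ, G.card := Finset.sum_lt_sum_of_nonempty hne hcon
          _ = Mᶜ.card * G.card := by simp
          _ ≤ _ := by gcongr
        have := lt_of_mul_lt_mul_left this (Nat.zero_le _)
        omega
      have hDr : IsRainbow χ (D A) := fun E hE => hG E (h2 A hE)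
      obtain ⟨D', hD', hk, hav⟩ := exists_avoiding k χ A (D A) hDr (h5 A hA)
      have hlt : (insert A M)ᶜ.card ≤ N := by
        rw [Finset.compl_insert, Finset.card_erase_of_mem hA]
        omega
      obtain ⟨J, G', hG', hJ, hle⟩ := hC V χ (insert A M) D' (fun E hE => hDr E (hD' hE)) (by
        intro B hB E hE E' hE'
        rcases Finset.mem_insert.1 hB with rfl | hB
        · exact hav E hE E' hE'
        · exact hM B hB E (h2 A (hD' hE)) E' (h2 A (hD' hE'))) hlt
      refine ⟨J, G', hG'.trans (hD'.trans (h2 A)), hJ, ?_⟩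
      calc G.card ≤ 2 * (2 ^ m * (D A).card) := hDA
        _ ≤ 2 * (2 ^ m * (k * (C * G'.card))) := by gcongr; exact hk.trans (by gcongr)
        _ = 2 * (2 ^ m * (k * C)) * G'.card := by ring
        _ ≤ _ := by gcongr; omega

/-- Some colouring makes at least a proportion `m ^ (-m)` of the edges of an `m`-graph rainbow. -/
theorem exists_rainbow {V : Type} [Fintype V] [DecidableEq V] {m : ℕ} (hm : 0 < m)
    (G : Finset (Finset V)) (hG : IsUniform m G) :
    ∃ χ : V → Fin m, ∃ G' ⊆ G, IsRainbow χ G' ∧ G.card ≤ m ^ m * G'.card := by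
  classical
  have : NeZero m := ⟨hm.ne'⟩
  let rb : (V → Fin m) → Finset (Finset V) := fun χ =>
    G.filter fun E => Set.BijOn χ (E : Set V) Set.univ
  suffices h : ∃ χ, G.card ≤ m ^ m * (rb χ).card by
    obtain ⟨χ, hχ⟩ := h
    exact ⟨χ, rb χ, Finset.filter_subset _ _, fun E hE => (Finset.mem_filter.1 hE).2, hχ⟩
  by_contra! hcon
  have hcount : ∀ E ∈ G, Fintype.card (V → Fin m) ≤
      m ^ m * (Finset.univ.filter fun χ : V → Fin m => Set.BijOn χ (E : Set V) Set.univ).card := by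
    intro E hE
    let e : E ≃ Fin m := Finset.equivFinOfCardEq (hG E hE)
    let S : V → Finset (Fin m) := fun v => if h : v ∈ E then {e ⟨v, h⟩} else Finset.univ
    have hsub : Fintype.piFinset S ⊆
        Finset.univ.filter fun χ : V → Fin m => Set.BijOn χ (E : Set V) Set.univ := by
      intro χ hχ
      have hval : ∀ v (h : v ∈ E), χ v = e ⟨v, h⟩ := by
        intro v h
        have := Fintype.mem_piFinset.1 hχ v
        simpa [S, h] using this
      refine Finset.mem_filter.2 ⟨Finset.mem_univ _, fun _ _ => Set.mem_univ _, ?_, ?_⟩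
      · intro x hx y hy hxy
        rw [hval x hx, hval y hy] at hxy
        simpa using hxy
      · intro i _
        exact ⟨e.symm i, (e.symm i).2, by rw [hval _ (e.symm i).2]; simp⟩
    have hcS : ∀ v, (S v).card = if v ∈ E then 1 else m := by
      intro v
      by_cases h : v ∈ E <;> simp [S, h]
    have hEc : E.card = m := hG E hE
    have hcard : m ^ m * (Fintype.piFinset S).card = Fintype.card (V → Fin m) := by
      rw [Fintype.card_piFinset, Finset.prod_congr rfl fun v _ => hcS v, Finset.prod_ite,
        Finset.prod_const_one, one_mul, Finset.prod_const, ← pow_add]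
      have : (Finset.univ.filter fun v => v ∉ E) = Eᶜ := by ext; simp
      rw [this, Finset.card_compl, hEc, Fintype.card_fun, Fintype.card_fin]
      congr 1
      have := Finset.card_le_univ E
      omega
    rw [← hcard]
    gcongr
  have hsum : Fintype.card (V → Fin m) * G.card < Fintype.card (V → Fin m) * G.card := calc
    Fintype.card (V → Fin m) * G.card = ∑ E ∈ G, Fintype.card (V → Fin m) := by
      simp [mul_comm]
    _ ≤ ∑ E ∈ G, m ^ m *
        (Finset.univ.filter fun χ : V → Fin m => Set.BijOn χ (E : Set V) Set.univ).card :=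
      Finset.sum_le_sum hcount
    _ = ∑ χ : V → Fin m, m ^ m * (rb χ).card := by
      rw [← Finset.mul_sum, ← Finset.mul_sum]
      congr 1
      exact (Finset.sum_card_bipartiteAbove_eq_sum_card_bipartiteBelow
        (fun (E : Finset V) (χ : V → Fin m) => Set.BijOn χ (E : Set V) Set.univ)
        (s := G) (t := Finset.univ))
    _ < ∑ χ : V → Fin m, G.card :=
      Finset.sum_lt_sum_of_nonempty Finset.univ_nonempty fun χ _ => hcon χ
    _ = _ := by simp
  exact lt_irrefl _ hsum

/-- Füredi's theorem: every `m`-graph contains a positive proportion of its edges that form a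
homogeneous family. -/
theorem exists_homogeneous (k : ℕ) {m : ℕ} (hm : 0 < m) : ∃ C : ℕ, ∀ (V : Type) [Fintype V]
    [DecidableEq V] (G : Finset (Finset V)), IsUniform m G →
    ∃ χ : V → Fin m, ∃ J, ∃ G' ⊆ G, IsHomogeneous k χ J G' ∧ G.card ≤ C * G'.card := by
  obtain ⟨C, hC⟩ := exists_homogeneous_of_rainbow k m (2 ^ m)
  refine ⟨m ^ m * C, fun V _ _ G hG => ?_⟩
  obtain ⟨χ, G₁, h₁, hr, hc₁⟩ := exists_rainbow hm G hG
  obtain ⟨J, G₂, h₂, hJ, hc₂⟩ := hC V χ ∅ G₁ hr (by simp) (by simp)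
  exact ⟨χ, J, G₂, h₂.trans h₁, hJ, hc₁.trans (by rw [mul_assoc]; gcongr)⟩

/-- The kernel types of a homogeneous family are closed under intersection. -/
theorem IsHomogeneous.inter_mem_of_mem {V : Type} [DecidableEq V] {m k : ℕ} {χ : V → Fin m}
    {J : Finset (Finset (Fin m))} {G : Finset (Finset V)} (hG : IsHomogeneous k χ J G)
    (hne : G.Nonempty) (hk : 2 * m ≤ k) {A B : Finset (Fin m)} (hA : A ∈ J) (hB : B ∈ J) :
    A ∩ B ∈ J := by
  obtain ⟨E, hE⟩ := hne
  have hEc := card_of_bijOn (hG.rainbow E hE)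
  obtain ⟨E₁, hE₁, hs₁, hd₁⟩ := hG.kernel A hA E hE E (by omega)
  have hE₁c := card_of_bijOn (hG.rainbow E₁ hE₁)
  obtain ⟨E₂, hE₂, hs₂, hd₂⟩ := hG.kernel B hB E hE (E ∪ E₁)
    ((Finset.card_union_le _ _).trans (by omega))
  have key : E₁ ∩ E₂ = part χ E (A ∩ B) := by
    rw [← part_inter_part]
    apply Finset.Subset.antisymm
    · intro x hx
      obtain ⟨hx₁, hx₂⟩ := Finset.mem_inter.1 hx
      have hxB : x ∈ part χ E B := by
        by_contra h
        exact Finset.disjoint_left.1 hd₂ (Finset.mem_sdiff.2 ⟨hx₂, h⟩)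
          (Finset.mem_union_right _ hx₁)
      have hxA : x ∈ part χ E A := by
        by_contra h
        exact Finset.disjoint_left.1 hd₁ (Finset.mem_sdiff.2 ⟨hx₁, h⟩) (part_subset hxB)
      exact Finset.mem_inter.2 ⟨hxA, hxB⟩
    · exact Finset.inter_subset_inter hs₁ hs₂
  have := hG.inter_mem E₁ hE₁ E₂ hE₂
  rwa [key, image_part (hG.rainbow E hE)] at this

/-- If a homogeneous family has complementary kernel types of sizes `a` and `b`, then every blowup
of a tree can be embedded greedily. -/
theorem IsHomogeneous.exists_blocks {s t a b : ℕ} {T : SimpleGraph (Fin s ⊕ Fin t)}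
    (hT : T.IsTree) (hbip : T ≤ completeBipartiteGraph (Fin s) (Fin t)) (hs : 0 < s)
    {V : Type} [DecidableEq V] {m k : ℕ} {χ : V → Fin m}
    {J : Finset (Finset (Fin m))} {G : Finset (Finset V)} (hG : IsHomogeneous k χ J G)
    (hne : G.Nonempty) (hk : s * a + t * b ≤ k) {A B : Finset (Fin m)} (hA : A ∈ J) (hB : B ∈ J)
    (hAB : A ∪ B = Finset.univ) (hd : Disjoint A B) (hAc : A.card = a) (hBc : B.card = b) :
    ∃ (f : Fin s → Finset V) (g : Fin t → Finset V), (∀ i, (f i).card = a) ∧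
      (∀ j, (g j).card = b) ∧
      (∀ i i', i ≠ i' → Disjoint (f i) (f i')) ∧ (∀ j j', j ≠ j' → Disjoint (g j) (g j')) ∧
      (∀ i j, Disjoint (f i) (g j)) ∧
      (∀ i j, T.Adj (Sum.inl i) (Sum.inr j) → f i ∪ g j ∈ G) ∧
      (∀ i, ∃ E ∈ G, f i ⊆ E) ∧ ∀ j, ∃ E ∈ G, g j ⊆ E := by
  classical
  let 𝒜 : Set (Finset V) := {C | ∃ E ∈ G, C = part χ E A}
  let ℬ : Set (Finset V) := {C | ∃ E ∈ G, C = part χ E B}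
  have h𝒜 : ∀ C ∈ 𝒜, C.card = a := by
    rintro _ ⟨E, hE, rfl⟩
    rw [card_part (hG.rainbow E hE), hAc]
  have hℬ : ∀ C ∈ ℬ, C.card = b := by
    rintro _ ⟨E, hE, rfl⟩
    rw [card_part (hG.rainbow E hE), hBc]
  -- the set of vertices used before has at most `k` elements
  have hQ : ∀ 𝒰 𝒱 : Finset (Finset V), (∀ C ∈ 𝒰, C ∈ 𝒜) → (∀ C ∈ 𝒱, C ∈ ℬ) →
      𝒰.card ≤ s → 𝒱.card ≤ t → (𝒰.biUnion id ∪ 𝒱.biUnion id).card ≤ k := by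
    intro 𝒰 𝒱 hU hV hcU hcV
    refine (Finset.card_union_le _ _).trans (le_trans (add_le_add ?_ ?_) hk)
    · exact (Finset.card_biUnion_le_card_mul _ _ a fun C hC => (h𝒜 C (hU C hC)).le).trans
        (by gcongr)
    · exact (Finset.card_biUnion_le_card_mul _ _ b fun C hC => (hℬ C (hV C hC)).le).trans
        (by gcongr)
  have hsplit : ∀ (𝒰 𝒱 : Finset (Finset V)) (X : Finset V),
      Disjoint X (𝒰.biUnion id ∪ 𝒱.biUnion id) →
      (∀ C ∈ 𝒰, Disjoint C X) ∧ ∀ C ∈ 𝒱, Disjoint C X := by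
    intro 𝒰 𝒱 X h
    rw [Finset.disjoint_union_right] at h
    exact ⟨fun C hC => (h.1.mono_right (Finset.subset_biUnion_of_mem id hC)).symm,
      fun C hC => (h.2.mono_right (Finset.subset_biUnion_of_mem id hC)).symm⟩
  obtain ⟨E₀, hE₀⟩ := hne
  obtain ⟨f, g, hf, hg, h1, h2, h3, h4⟩ := HypergraphBlowup.exists_blocks hT hbip hs 𝒜 ℬ
    (fun X Y => X ∪ Y ∈ G) ⟨_, E₀, hE₀, rfl⟩
    (by
      rintro _ ⟨E, hE, rfl⟩ 𝒰 𝒱 hU hV hcU hcV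
      obtain ⟨E', hE', hsub, hdis⟩ := hG.kernel A hA E hE _ (hQ 𝒰 𝒱 hU hV hcU hcV.le)
      have he := part_eq_of_subset (hG.rainbow E hE) (hG.rainbow E' hE') hsub
      rw [← he, sdiff_part_eq hAB hd] at hdis
      refine ⟨part χ E' B, ⟨E', hE', rfl⟩, ?_, hsplit _ _ _ hdis⟩
      rwa [← he, part_union_part hAB])
    (by
      rintro _ ⟨E, hE, rfl⟩ 𝒰 𝒱 hU hV hcU hcV
      obtain ⟨E', hE', hsub, hdis⟩ := hG.kernel B hB E hE _ (hQ 𝒰 𝒱 hU hV hcU.le hcV)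
      have he := part_eq_of_subset (hG.rainbow E hE) (hG.rainbow E' hE') hsub
      rw [← he, sdiff_part_eq (Finset.union_comm A B ▸ hAB) hd.symm] at hdis
      refine ⟨part χ E' A, ⟨E', hE', rfl⟩, ?_, hsplit _ _ _ hdis⟩
      rwa [← he, part_union_part hAB])
  refine ⟨f, g, fun i => h𝒜 _ (hf i), fun j => hℬ _ (hg j), h1, h2, h3, h4, ?_, ?_⟩
  · intro i
    obtain ⟨E, hE, h⟩ := hf i
    exact ⟨E, hE, h ▸ part_subset⟩
  · intro j
    obtain ⟨E, hE, h⟩ := hg j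
    exact ⟨E, hE, h ▸ part_subset⟩

/-! ### The structure of homogeneous families without a blowup of a tree -/

theorem mem_of_forall_compl_singleton_mem {m : ℕ} {J : Finset (Finset (Fin m))}
    (hu : Finset.univ ∈ J) (hinter : ∀ A ∈ J, ∀ B ∈ J, A ∩ B ∈ J) {A : Finset (Fin m)}
    (hA : ∀ i ∉ A, {i}ᶜ ∈ J) : A ∈ J := by
  have : A = Aᶜ.inf fun i => {i}ᶜ := by
    ext x
    simp only [Finset.mem_inf, Finset.mem_compl, Finset.mem_singleton]
    constructor
    · rintro h i hi rfl
      exact hi h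
    · intro h
      by_contra hx
      exact h x hx rfl
  rw [this]
  exact Finset.inf_induction (p := fun A => A ∈ J) hu (fun A hA B hB => hinter A hA B hB)
    fun i hi => hA i (Finset.mem_compl.1 hi)

/-- An intersection-closed family of subsets of an `m`-set without complementary members of sizes
`a > b` is of one of three kinds: some `(m - 2)`-set has no superset in the family except possibly
the whole set; or there is a central element `y` such that no member of size at least `m - 2`
avoids `y`; or `b = 1` and the family contains no `(m - 1)`-set. The cases are distinguished by the
size of the set `Y` of all `y` for which the complement of `y` is not in the family. -/
theorem kernel_types_trichotomy {m a b : ℕ} (J : Finset (Finset (Fin m)))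
    (hu : Finset.univ ∈ J) (hinter : ∀ A ∈ J, ∀ B ∈ J, A ∩ B ∈ J) (hab : a + b = m) (hb : 1 ≤ b)
    (hba : b < a)
    (hno : ∀ A ∈ J, Aᶜ ∈ J → A.card = a → False) :
    (∃ x y, x ≠ y ∧ {x}ᶜ ∉ J ∧ {y}ᶜ ∉ J ∧ {x, y}ᶜ ∉ J) ∨
    (∃ y, {y}ᶜ ∉ J ∧ ∀ z, z ≠ y → {y, z}ᶜ ∉ J) ∨
    (b = 1 ∧ ∀ y, {y}ᶜ ∉ J) := by
  by_cases hα : ∃ x y, x ≠ y ∧ {x}ᶜ ∉ J ∧ {y}ᶜ ∉ J ∧ {x, y}ᶜ ∉ J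
  · exact Or.inl hα
  right
  push Not at hα
  let Y : Finset (Fin m) := Finset.univ.filter fun y => {y}ᶜ ∉ J
  have hY : ∀ y, y ∉ Y → {y}ᶜ ∈ J := by
    intro y hy
    simpa [Y] using hy
  have hY' : ∀ y ∈ Y, {y}ᶜ ∉ J := by
    intro y hy
    simpa [Y] using hy
  have hpair : ∀ x ∈ Y, ∀ y ∈ Y, x ≠ y → {x, y}ᶜ ∈ J := fun x hx y hy hne =>
    hα x y hne (hY' x hx) (hY' y hy)
  have hinf : ∀ (I : Finset (Fin m)) (f : Fin m → Finset (Fin m)), (∀ i ∈ I, f i ∈ J) →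
      I.inf f ∈ J := fun I f hf =>
    Finset.inf_induction (p := fun A => A ∈ J) hu (fun A hA B hB => hinter A hA B hB) hf
  -- sets that miss no element or at least two elements of `Y` belong to the family
  have h0 : ∀ A : Finset (Fin m), Y ⊆ A → A ∈ J := by
    intro A hA
    exact mem_of_forall_compl_singleton_mem hu hinter fun i hi => hY i fun h => hi (hA h)
  have h2 : ∀ A : Finset (Fin m), 2 ≤ (Y \ A).card → A ∈ J := by
    intro A hA
    obtain ⟨x, hx, y, hy, hxy⟩ := Finset.one_lt_card.1 hA
    have hx' := Finset.mem_sdiff.1 hx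
    have : A = (A ∪ Y) ∩ ((Y \ A).erase x).inf fun z => {x, z}ᶜ := by
      ext u
      simp only [Finset.mem_inter, Finset.mem_union, Finset.mem_inf, Finset.mem_erase,
        Finset.mem_sdiff, Finset.mem_compl, Finset.mem_insert, Finset.mem_singleton]
      constructor
      · refine fun h => ⟨Or.inl h, ?_⟩
        rintro z ⟨-, -, hz⟩ (rfl | rfl)
        · exact hx'.2 h
        · exact hz h
      · rintro ⟨h | h, h'⟩
        · exact h
        · by_contra hu
          have hy' := Finset.mem_sdiff.1 hy
          by_cases hux : u = x
          · exact h' y ⟨hxy.symm, hy'⟩ (Or.inl hux)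
          · exact h' u ⟨hux, h, hu⟩ (Or.inr rfl)
    rw [this]
    refine hinter _ (h0 _ Finset.subset_union_right) _ (hinf _ _ fun z hz => ?_)
    have hz' := Finset.mem_erase.1 hz
    exact hpair x hx'.1 z (Finset.mem_sdiff.1 hz'.2).1 hz'.1.symm
  have hYle : Y.card ≤ m := by simpa using Finset.card_le_univ Y
  rcases Nat.lt_or_ge a Y.card with hlarge | hsmall
  · by_cases hb1 : b = 1
    · right
      refine ⟨hb1, fun y => hY' y ?_⟩
      have : Y = Finset.univ := (Finset.card_eq_iff_eq_univ Y).1 (by simp; omega)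
      exact this ▸ Finset.mem_univ _
    · exfalso
      obtain ⟨B, hB, hBc⟩ := Finset.exists_subset_card_eq (show b ≤ Y.card by omega)
      refine hno Bᶜ (h2 _ ?_) (h2 _ ?_) ?_
      · rw [sdiff_compl, Finset.inf_eq_inter, Finset.inter_eq_right.2 hB]
        omega
      · rw [compl_compl, Finset.card_sdiff_of_subset hB]
        omega
      · rw [Finset.card_compl, Fintype.card_fin]
        omega
  · obtain ⟨A, hA, hAc⟩ := Finset.exists_superset_card_eq hsmall (by simp; omega)
    by_cases hY1 : Y.card = 1
    · left
      obtain ⟨y, hy⟩ := Finset.card_eq_one.1 hY1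
      refine ⟨y, hY' y (by simp [hy]), fun z hz hmem => ?_⟩
      -- a `b`-set avoiding `y` and its complement would both be kernel types
      have hAy : y ∈ A := hA (by simp [hy])
      obtain ⟨B, hB, hBc⟩ := Finset.exists_subset_card_eq
        (s := ({y, z} : Finset (Fin m))ᶜ) (n := b) (by
          rw [Finset.card_compl, Fintype.card_fin, Finset.card_pair hz.symm]
          omega)
      have hyB : y ∉ B := fun h => by simpa using hB h
      refine hno Bᶜ (h0 _ (by simp [hy, hyB])) ?_ ?_
      · rw [compl_compl]
        have : B = {y, z}ᶜ ∩ insert y B := by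
          ext u
          simp only [Finset.mem_inter, Finset.mem_insert]
          constructor
          · exact fun h => ⟨hB h, Or.inr h⟩
          · rintro ⟨h, rfl | h'⟩
            · simp at h
            · exact h'
        rw [this]
        exact hinter _ hmem _ (h0 _ (by simp [hy]))
      · rw [Finset.card_compl, Fintype.card_fin]
        omega
    · exfalso
      refine hno A (h0 A hA) ?_ hAc
      rcases Nat.eq_zero_or_pos Y.card with h | h
      · exact h0 _ (by simp [Finset.card_eq_zero.1 h])
      · refine h2 _ ?_
        rw [sdiff_compl, Finset.inf_eq_inter, Finset.inter_eq_left.2 hA]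
        omega

/-- If a colour set `K` has no proper superset among the intersection types, then the parts
coloured by `K` determine the edges. -/
theorem IsHomogeneous.eq_of_part_subset {V : Type} [DecidableEq V] {m k : ℕ} {χ : V → Fin m}
    {J : Finset (Finset (Fin m))} {G : Finset (Finset V)} (hG : IsHomogeneous k χ J G)
    {K : Finset (Fin m)} (hK : ∀ A ∈ J, K ⊆ A → A = Finset.univ) {E E' : Finset V} (hE : E ∈ G)
    (hE' : E' ∈ G) (h : part χ E K ⊆ E') : E = E' := by
  have hKsub : K ⊆ (E ∩ E').image χ := by
    rw [← image_part (A := K) (hG.rainbow E hE)]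
    exact Finset.image_subset_image (Finset.subset_inter part_subset h)
  have himg := hK _ (hG.inter_mem E hE E' hE') hKsub
  have h1 : E ∩ E' = E := by
    rw [inter_eq_part (hG.rainbow E hE), himg]
    ext x
    simp [mem_part]
  refine Finset.eq_of_subset_of_card_le (Finset.inter_eq_left.1 h1) ?_
  rw [card_of_bijOn (hG.rainbow E hE), card_of_bijOn (hG.rainbow E' hE')]

theorem IsHomogeneous.card_le_choose {V : Type} [Fintype V] [DecidableEq V] {m k : ℕ}
    {χ : V → Fin m} {J : Finset (Finset (Fin m))} {G : Finset (Finset V)}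
    (hG : IsHomogeneous k χ J G) {K : Finset (Fin m)}
    (hK : ∀ A ∈ J, K ⊆ A → A = Finset.univ) :
    G.card ≤ (Fintype.card V).choose K.card := by
  rw [← Finset.card_univ, ← Finset.card_powersetCard]
  refine Finset.card_le_card_of_injOn (fun E => part χ E K) ?_ ?_
  · intro E hE
    simp [card_part (hG.rainbow E hE)]
  · intro E hE E' hE' h
    exact hG.eq_of_part_subset hK hE hE' ((show part χ E K = part χ E' K from h) ▸ part_subset)

theorem eq_univ_of_compl_singleton_subset {m : ℕ} {J : Finset (Finset (Fin m))} {y : Fin m}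
    (hy : {y}ᶜ ∉ J) : ∀ A ∈ J, {y}ᶜ ⊆ A → A = Finset.univ := by
  intro A hA hsub
  by_contra hne
  refine hy ?_
  convert hA using 1
  refine Finset.Subset.antisymm hsub fun u hu => ?_
  rw [Finset.mem_compl, Finset.mem_singleton]
  rintro rfl
  refine hne (Finset.eq_univ_iff_forall.2 fun v => ?_)
  rcases eq_or_ne v u with rfl | h
  · exact hu
  · exact hsub (by simpa using h)

theorem eq_univ_of_compl_pair_subset {m : ℕ} {J : Finset (Finset (Fin m))} {x y : Fin m}
    (hx : {x}ᶜ ∉ J) (hy : {y}ᶜ ∉ J) (hxy : {x, y}ᶜ ∉ J) :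
    ∀ A ∈ J, {x, y}ᶜ ⊆ A → A = Finset.univ := by
  intro A hA hsub
  by_cases hxA : x ∈ A
  · refine eq_univ_of_compl_singleton_subset hy A hA fun u hu => ?_
    rcases eq_or_ne u x with rfl | h
    · exact hxA
    · exact hsub (by simpa [h] using hu)
  · by_cases hyA : y ∈ A
    · refine eq_univ_of_compl_singleton_subset hx A hA fun u hu => ?_
      rcases eq_or_ne u y with rfl | h
      · exact hyA
      · exact hsub (by simpa [h] using hu)
    · refine absurd ?_ hxy
      convert hA using 1
      refine Finset.Subset.antisymm hsub fun u hu => ?_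
      simp only [Finset.mem_compl, Finset.mem_insert, Finset.mem_singleton]
      rintro (rfl | rfl)
      · exact hxA hu
      · exact hyA hu

open scoped FinsetFamily in
/-- A consequence of the Kruskal–Katona theorem: a family of `m`-sets that is small compared with
the family of all `m`-subsets of an `x`-set is at most `x` times as large as its shadow. -/
theorem card_le_mul_card_shadow {n m x : ℕ} (hm : 0 < m) (G : Finset (Finset (Fin n)))
    (hG : IsUniform m G) (hx : G.card < x.choose m) : G.card ≤ x * (∂ G).card := by
  rcases G.eq_empty_or_nonempty with rfl | hne
  · simp
  have hpos := hne.card_pos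
  have hex : ∃ k : ℕ, G.card < k.choose m := ⟨x, hx⟩
  obtain ⟨k', hk', hmin⟩ : ∃ k : ℕ, G.card < k.choose m ∧ ∀ j < k, ¬ G.card < j.choose m :=
    ⟨Nat.find hex, Nat.find_spec hex, fun j hj => Nat.find_min hex hj⟩
  have hmk' : m < k' := by
    by_contra h
    rcases Nat.lt_or_ge k' m with h' | h'
    · rw [Nat.choose_eq_zero_of_lt h'] at hk'
      omega
    · obtain rfl : k' = m := by omega
      rw [Nat.choose_self] at hk'
      omega
  obtain ⟨k, rfl⟩ : ∃ k, k' = k + 1 := ⟨k' - 1, by omega⟩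
  obtain ⟨l, rfl⟩ : ∃ l, m = l + 1 := ⟨m - 1, by omega⟩
  have hsized : (G : Set (Finset (Fin n))).Sized (l + 1) := fun E hE => hG E hE
  have hGle : G.card ≤ n.choose (l + 1) := by simpa using hsized.card_le
  have hkn : k ≤ n := by
    by_contra h
    refine hmin (n + 1) (by omega) (hGle.trans_lt ?_)
    rw [Nat.choose_succ_succ']
    have hln : l + 1 ≤ n := by
      by_contra h'
      rw [Nat.choose_eq_zero_of_lt (by omega)] at hGle
      omega
    have := Nat.choose_pos (n := n) (k := l) (by omega)
    omega
  have hkx : k + 1 ≤ x := by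
    by_contra h
    exact hmin x (by omega) hx
  have hkk := Finset.kruskal_katona_lovasz_form (i := 1) (r := l + 1) (k := k) (by omega)
    (by omega) hkn hsized (not_lt.1 (hmin k (by omega)))
  simp only [Function.iterate_one, Nat.add_sub_cancel] at hkk
  have hid := Nat.add_one_mul_choose_eq k l
  calc G.card ≤ (k + 1).choose (l + 1) := hk'.le
    _ ≤ (k + 1).choose (l + 1) * (l + 1) := Nat.le_mul_of_pos_right _ (by omega)
    _ = (k + 1) * k.choose l := hid.symm
    _ ≤ x * (∂ G).card := Nat.mul_le_mul hkx hkk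

open scoped FinsetFamily in
/-- In a homogeneous family with a central colour, few vertices of that colour have large degree,
and few edges have their central vertex elsewhere. The point is that the shadows of the links of
the central vertices are pairwise disjoint, while small links have relatively large shadows. -/
theorem IsHomogeneous.exists_centers {n r k : ℕ} (hr : 3 ≤ r) {χ : Fin n → Fin r}
    {J : Finset (Finset (Fin r))} {G : Finset (Finset (Fin n))} (hG : IsHomogeneous k χ J G)
    {y : Fin r} (hy : {y}ᶜ ∉ J) (hyz : ∀ z, z ≠ y → {y, z}ᶜ ∉ J) (x : ℕ) :
    ∃ W : Finset (Fin n), W.card * x.choose (r - 1) ≤ n.choose (r - 1) ∧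
      (G.filter fun E => Disjoint E W).card ≤ x * n.choose (r - 2) := by
  classical
  let star : Fin n → Finset (Finset (Fin n)) := fun i => G.filter fun E => i ∈ E ∧ χ i = y
  let link : Fin n → Finset (Finset (Fin n)) := fun i => (star i).image fun E => E.erase i
  have hstar : ∀ i E, E ∈ star i ↔ E ∈ G ∧ i ∈ E ∧ χ i = y := fun i E => Finset.mem_filter
  have hlinkcard : ∀ i, (link i).card = (star i).card := by
    intro i
    refine Finset.card_image_of_injOn fun E hE E' hE' h => ?_
    have h1 := ((hstar i E).1 hE).2.1
    have h2 := ((hstar i E').1 hE').2.1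
    rw [← Finset.insert_erase h1, ← Finset.insert_erase h2]
    exact congrArg _ h
  have hcardE : ∀ E ∈ G, E.card = r := fun E hE => card_of_bijOn (hG.rainbow E hE)
  have hlinkU : ∀ i, IsUniform (r - 1) (link i) := by
    intro i F hF
    obtain ⟨E, hE, rfl⟩ := Finset.mem_image.1 hF
    have hE' := (hstar i E).1 hE
    rw [Finset.card_erase_of_mem hE'.2.1, hcardE E hE'.1]
  have hstardisj : ∀ i j, i ≠ j → Disjoint (star i) (star j) := by
    intro i j hij
    refine Finset.disjoint_left.2 fun E hi hj => hij ?_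
    have hi' := (hstar i E).1 hi
    have hj' := (hstar j E).1 hj
    exact (hG.rainbow E hi'.1).injOn hi'.2.1 hj'.2.1 (hi'.2.2.trans hj'.2.2.symm)
  have hshadow : ∀ i D, D ∈ ∂ (link i) → D.card = r - 2 ∧ ∃ E ∈ star i, D ⊆ E := by
    intro i D hD
    obtain ⟨F, hF, u, hu, rfl⟩ := Finset.mem_shadow_iff.1 hD
    have hFc := hlinkU i F hF
    obtain ⟨E, hE, rfl⟩ := Finset.mem_image.1 hF
    refine ⟨by rw [Finset.card_erase_of_mem hu, hFc]; omega, E, hE,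
      (Finset.erase_subset _ _).trans (Finset.erase_subset _ _)⟩
  have hshdisj : ∀ i j, i ≠ j → Disjoint (∂ (link i)) (∂ (link j)) := by
    intro i j hij
    refine Finset.disjoint_left.2 fun D hi hj => ?_
    obtain ⟨hDc, E, hE, hDE⟩ := hshadow i D hi
    obtain ⟨-, E', hE', hDE'⟩ := hshadow j D hj
    obtain ⟨hEG, hiE, hiy⟩ := (hstar i E).1 hE
    obtain ⟨hEG', hjE', hjy⟩ := (hstar j E').1 hE'
    have hmem := hG.inter_mem E hEG E' hEG'
    set A := (E ∩ E').image χ with hA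
    have hAc : r - 2 ≤ A.card := by
      rw [hA, Finset.card_image_of_injOn, ← hDc]
      · exact Finset.card_le_card (Finset.subset_inter hDE hDE')
      · exact (hG.rainbow E hEG).injOn.mono (Finset.coe_subset.2 Finset.inter_subset_left)
    have hyA : y ∉ A := by
      intro h
      obtain ⟨v, hv, hvy⟩ := Finset.mem_image.1 h
      obtain ⟨hvE, hvE'⟩ := Finset.mem_inter.1 hv
      have e1 := (hG.rainbow E hEG).injOn hvE hiE (hvy.trans hiy.symm)
      have e2 := (hG.rainbow E' hEG').injOn hvE' hjE' (hvy.trans hjy.symm)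
      exact hij (e1.symm.trans e2)
    by_cases hz : ∃ z, z ≠ y ∧ z ∉ A
    · obtain ⟨z, hzy, hzA⟩ := hz
      refine hyz z hzy ?_
      convert hmem using 1
      symm
      refine Finset.eq_of_subset_of_card_le (fun u hu => ?_) ?_
      · simp only [Finset.mem_compl, Finset.mem_insert, Finset.mem_singleton]
        rintro (rfl | rfl)
        · exact hyA hu
        · exact hzA hu
      · rw [Finset.card_compl, Fintype.card_fin, Finset.card_pair hzy.symm]
        exact hAc
    · push Not at hz
      refine hy ?_
      convert hmem using 1
      ext u
      simp only [Finset.mem_compl, Finset.mem_singleton]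
      exact ⟨fun h => hz u h, fun h h' => hyA (h' ▸ h)⟩
  let W : Finset (Fin n) := Finset.univ.filter fun i => x.choose (r - 1) ≤ (star i).card
  refine ⟨W, ?_, ?_⟩
  · have hGle : G.card ≤ n.choose (r - 1) := by
      have h := hG.card_le_choose (eq_univ_of_compl_singleton_subset hy)
      rwa [Finset.card_compl, Finset.card_singleton, Fintype.card_fin, Fintype.card_fin] at h
    refine le_trans ?_ hGle
    calc W.card * x.choose (r - 1) = ∑ i ∈ W, x.choose (r - 1) := by simp
      _ ≤ ∑ i ∈ W, (star i).card := Finset.sum_le_sum fun i hi => (Finset.mem_filter.1 hi).2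
      _ = (W.biUnion star).card := (Finset.card_biUnion fun i _ j _ h => hstardisj i j h).symm
      _ ≤ G.card := Finset.card_le_card
        (Finset.biUnion_subset.2 fun i _ => Finset.filter_subset _ _)
  · have hsub : (G.filter fun E => Disjoint E W) ⊆ Wᶜ.biUnion star := by
      intro E hE
      obtain ⟨hEG, hEW⟩ := Finset.mem_filter.1 hE
      obtain ⟨i, hi, hiy⟩ := (hG.rainbow E hEG).surjOn (Set.mem_univ y)
      refine Finset.mem_biUnion.2 ⟨i, ?_, (hstar i E).2 ⟨hEG, hi, hiy⟩⟩
      exact Finset.mem_compl.2 fun h => Finset.disjoint_left.1 hEW hi h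
    calc (G.filter fun E => Disjoint E W).card ≤ ∑ i ∈ Wᶜ, (star i).card :=
          (Finset.card_le_card hsub).trans Finset.card_biUnion_le
      _ ≤ ∑ i ∈ Wᶜ, x * (∂ (link i)).card := by
        refine Finset.sum_le_sum fun i hi => ?_
        rw [← hlinkcard]
        refine card_le_mul_card_shadow (by omega) _ (hlinkU i) ?_
        rw [hlinkcard]
        simpa [W] using hi
      _ = x * (Wᶜ.biUnion fun i => ∂ (link i)).card := by
        rw [Finset.card_biUnion fun i _ j _ h => hshdisj i j h, Finset.mul_sum]
      _ ≤ x * n.choose (r - 2) := by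
        gcongr
        have hle : (Wᶜ.biUnion fun i => ∂ (link i)) ⊆
            Finset.powersetCard (r - 2) (Finset.univ : Finset (Fin n)) := by
          refine Finset.biUnion_subset.2 fun i _ D hD => ?_
          exact Finset.mem_powersetCard.2 ⟨Finset.subset_univ _, (hshadow i D hD).1⟩
        simpa using Finset.card_le_card hle

/-- A homogeneous family without the blowup of a tree consists of edges meeting a small set `W`, of
edges any two of which share at most `r - 2` vertices (only if `b = 1`), and of few other edges. -/
theorem IsHomogeneous.structure {n r s t a b k : ℕ} (hr : 3 ≤ r) (hab : a + b = r) (hb : 1 ≤ b)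
    (hba : b < a) (hs : 0 < s) {T : SimpleGraph (Fin s ⊕ Fin t)} (hT : T.IsTree)
    (hbip : T ≤ completeBipartiteGraph (Fin s) (Fin t)) {χ : Fin n → Fin r}
    {J : Finset (Finset (Fin r))} {G : Finset (Finset (Fin n))} (hG : IsHomogeneous k χ J G)
    (hk : s * a + t * b ≤ k) (hk' : 2 * r ≤ k) (hfree : IsFree (blowup T a b) G) (x : ℕ) :
    G.card ≤ n.choose (r - 1) ∧ ∃ W : Finset (Fin n), ∃ S ⊆ G,
      W.card * x.choose (r - 1) ≤ n.choose (r - 1) ∧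
      (∀ E ∈ S, ∀ E' ∈ S, r - 1 ≤ (E ∩ E').card → E = E') ∧ (b ≠ 1 → S = ∅) ∧
      (G.filter fun E => Disjoint E W ∧ E ∉ S).card ≤ (x + 1) * n.choose (r - 2) := by
  classical
  rcases G.eq_empty_or_nonempty with rfl | hne
  · exact ⟨by simp, ∅, ∅, by simp⟩
  obtain ⟨E₀, hE₀⟩ := hne
  have hu : Finset.univ ∈ J := by
    have h := hG.inter_mem E₀ hE₀ E₀ hE₀
    rwa [Finset.inter_self, show E₀.image χ = Finset.univ from
      Finset.eq_univ_iff_forall.2 fun i => by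
        obtain ⟨v, hv, rfl⟩ := (hG.rainbow E₀ hE₀).surjOn (Set.mem_univ i)
        exact Finset.mem_image_of_mem _ hv] at h
  have hsingle : ∀ y, {y}ᶜ ∉ J → G.card ≤ n.choose (r - 1) := by
    intro y hy
    have h := hG.card_le_choose (eq_univ_of_compl_singleton_subset hy)
    rwa [Finset.card_compl, Finset.card_singleton, Fintype.card_fin, Fintype.card_fin] at h
  rcases kernel_types_trichotomy (a := a) (b := b) J hu
    (fun A hA B hB => hG.inter_mem_of_mem ⟨E₀, hE₀⟩ hk' hA hB) hab hb hba (by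
      intro A hA hA' hAc
      obtain ⟨f, g, h1, h2, h3, h4, h5, h6, -⟩ := hG.exists_blocks hT hbip hs ⟨E₀, hE₀⟩ hk hA hA'
        (by simp) disjoint_compl_right hAc
        (by rw [Finset.card_compl, Fintype.card_fin]; omega)
      exact hfree (containsCopy_of_blocks f g h1 h2 h3 h4 h5 h6)) with
    ⟨u, v, huv, hu1, hv1, huv1⟩ | ⟨y, hy, hyz⟩ | ⟨hb1, hJ⟩
  · refine ⟨hsingle u hu1, ∅, ∅, by simp, by simp, by simp, by simp, ?_⟩
    have h := hG.card_le_choose (eq_univ_of_compl_pair_subset hu1 hv1 huv1)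
    rw [Finset.card_compl, Finset.card_pair huv, Fintype.card_fin, Fintype.card_fin] at h
    refine (Finset.card_le_card (Finset.filter_subset _ _)).trans (h.trans ?_)
    exact Nat.le_mul_of_pos_left _ (by omega)
  · obtain ⟨W, hW, hW'⟩ := hG.exists_centers hr hy hyz x
    refine ⟨hsingle y hy, W, ∅, by simp, hW, by simp, by simp, ?_⟩
    simp only [Finset.notMem_empty, not_false_eq_true, and_true]
    exact hW'.trans (by gcongr; omega)
  · refine ⟨hsingle ⟨0, by omega⟩ (hJ _), ∅, G, subset_rfl, by simp, ?_, fun h => absurd hb1 h, ?_⟩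
    · intro E hE E' hE' hc
      by_contra hne
      have hcard : (E ∩ E').card < r := by
        rw [← card_of_bijOn (hG.rainbow E hE)]
        refine Finset.card_lt_card (Finset.ssubset_iff_subset_ne.2
          ⟨Finset.inter_subset_left, fun h => hne ?_⟩)
        refine Finset.eq_of_subset_of_card_le (Finset.inter_eq_left.1 h) ?_
        rw [card_of_bijOn (hG.rainbow E hE), card_of_bijOn (hG.rainbow E' hE')]
      have himg : ((E ∩ E').image χ).card = r - 1 := by
        rw [Finset.card_image_of_injOn
          ((hG.rainbow E hE).injOn.mono (Finset.coe_subset.2 Finset.inter_subset_left))]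
        omega
      have hcc : ((E ∩ E').image χ)ᶜ.card = 1 := by
        rw [Finset.card_compl, Fintype.card_fin, himg]
        omega
      obtain ⟨y, hy⟩ := Finset.card_eq_one.1 hcc
      refine hJ y ?_
      rw [← hy, compl_compl]
      exact hG.inter_mem E hE E' hE'
    · have : (G.filter fun E => Disjoint E (∅ : Finset (Fin n)) ∧ E ∉ G) = ∅ := by
        ext E
        simp
      rw [this]
      simp

/-! ### The structure of hypergraphs without a blowup of a tree -/

/-- Splitting off homogeneous subfamilies again and again leaves an arbitrarily small proportion of
the edges. -/
theorem exists_decomposition (k : ℕ) {m : ℕ} (hm : 0 < m) : ∃ C : ℕ, 0 < C ∧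
    ∀ (p : ℕ) (V : Type) [Fintype V] [DecidableEq V] (G : Finset (Finset V)), IsUniform m G →
    ∃ 𝒢 : Finset (Finset (Finset V)), 𝒢.card ≤ p ∧
      (∀ G' ∈ 𝒢, G' ⊆ G ∧ ∃ (χ : V → Fin m) (J : Finset (Finset (Fin m))),
        IsHomogeneous k χ J G') ∧
      ((G.filter fun E => ∀ G' ∈ 𝒢, E ∉ G').card : ℝ) ≤ (1 - 1 / (C : ℝ)) ^ p * G.card := by
  classical
  obtain ⟨C₀, hC₀⟩ := exists_homogeneous k hm
  refine ⟨C₀ + 1, by omega, fun p V _ _ G hG => ?_⟩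
  have hCpos : (0 : ℝ) < (C₀ + 1 : ℕ) := by positivity
  induction p with
  | zero => exact ⟨∅, by simp, by simp, by simp⟩
  | succ p ih =>
    obtain ⟨𝒢, hp, h𝒢, hrest⟩ := ih
    set R := G.filter fun E => ∀ G' ∈ 𝒢, E ∉ G' with hR
    obtain ⟨χ, J, G', hG', hJ, hcard⟩ := hC₀ V R
      (fun E hE => hG E (Finset.filter_subset _ _ hE))
    refine ⟨insert G' 𝒢, (Finset.card_insert_le _ _).trans (by omega), ?_, ?_⟩
    · intro G'' hG''
      rcases Finset.mem_insert.1 hG'' with rfl | h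
      · exact ⟨hG'.trans (Finset.filter_subset _ _), χ, J, hJ⟩
      · exact h𝒢 _ h
    · have heq : (G.filter fun E => ∀ G'' ∈ insert G' 𝒢, E ∉ G'') = R \ G' := by
        ext E
        simp only [hR, Finset.mem_filter, Finset.mem_sdiff, Finset.forall_mem_insert]
        tauto
      rw [heq, Finset.card_sdiff_of_subset hG', Nat.cast_sub (Finset.card_le_card hG')]
      have h1 : (R.card : ℝ) ≤ (C₀ + 1 : ℕ) * (G'.card : ℝ) := by
        have : R.card ≤ (C₀ + 1) * G'.card := hcard.trans (by gcongr; omega)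
        exact_mod_cast this
      have h2 : 1 / ((C₀ + 1 : ℕ) : ℝ) * R.card ≤ G'.card := by
        rw [div_mul_eq_mul_div, one_mul, div_le_iff₀ hCpos]
        linarith
      have h3 : (0 : ℝ) ≤ 1 - 1 / ((C₀ + 1 : ℕ) : ℝ) := by
        rw [sub_nonneg, div_le_one hCpos]
        exact_mod_cast Nat.succ_le_succ (Nat.zero_le _)
      calc (R.card : ℝ) - G'.card ≤ (1 - 1 / ((C₀ + 1 : ℕ) : ℝ)) * R.card := by linarith
        _ ≤ (1 - 1 / ((C₀ + 1 : ℕ) : ℝ)) *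
            ((1 - 1 / ((C₀ + 1 : ℕ) : ℝ)) ^ p * G.card) := by gcongr
        _ = _ := by ring

/-- Few edges contain at least two vertices of a given set. -/
theorem card_filter_two_le {n r : ℕ} (hr : 2 ≤ r) (H : Finset (Finset (Fin n)))
    (hH : IsUniform r H) (W : Finset (Fin n)) :
    (H.filter fun E => 2 ≤ (E ∩ W).card).card ≤ W.card ^ 2 * n ^ (r - 2) := by
  classical
  have hsub : (H.filter fun E => 2 ≤ (E ∩ W).card) ⊆ (W ×ˢ W).biUnion fun x =>
      (Finset.powersetCard (r - 2) Finset.univ).image fun D => insert x.1 (insert x.2 D) := by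
    intro E hE
    obtain ⟨hEH, hE2⟩ := Finset.mem_filter.1 hE
    obtain ⟨u, hu, v, hv, huv⟩ := Finset.one_lt_card.1 hE2
    obtain ⟨huE, huW⟩ := Finset.mem_inter.1 hu
    obtain ⟨hvE, hvW⟩ := Finset.mem_inter.1 hv
    have hvE' : v ∈ E.erase u := Finset.mem_erase.2 ⟨huv.symm, hvE⟩
    refine Finset.mem_biUnion.2 ⟨(u, v), Finset.mem_product.2 ⟨huW, hvW⟩,
      Finset.mem_image.2 ⟨(E.erase u).erase v, ?_, ?_⟩⟩
    · rw [Finset.mem_powersetCard, Finset.card_erase_of_mem hvE', Finset.card_erase_of_mem huE,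
        hH E hEH]
      exact ⟨Finset.subset_univ _, by omega⟩
    · simp only
      rw [Finset.insert_erase hvE', Finset.insert_erase huE]
  refine (Finset.card_le_card hsub).trans ((Finset.card_biUnion_le_card_mul _ _ (n ^ (r - 2))
    fun x _ => Finset.card_image_le.trans ?_).trans ?_)
  · simpa using Nat.choose_le_pow n (r - 2)
  · rw [Finset.card_product, sq]

theorem choose_le_mul_choose_div {n m L : ℕ} (hL : 0 < L) (hn : 2 * L * (m + 1) ≤ n) :
    n.choose m ≤ (4 * L) ^ m * m.factorial * (n / L).choose m := by
  set x := n / L with hx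
  have hx2 : 2 * (m + 1) ≤ x := by
    rw [hx, Nat.le_div_iff_mul_le hL]
    linarith
  have hnx : n < L * (x + 1) := by
    rw [hx]
    exact Nat.lt_mul_div_succ n hL
  have hle : n ≤ 4 * L * (x + 1 - m) := by
    have : x + 1 ≤ 4 * (x + 1 - m) := by omega
    calc n ≤ L * (x + 1) := hnx.le
      _ ≤ L * (4 * (x + 1 - m)) := by gcongr
      _ = _ := by ring
  calc n.choose m ≤ n ^ m := Nat.choose_le_pow n m
    _ ≤ (4 * L * (x + 1 - m)) ^ m := by gcongr
    _ = (4 * L) ^ m * (x + 1 - m) ^ m := mul_pow _ _ _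
    _ ≤ (4 * L) ^ m * (m.factorial * x.choose m) := by
      gcongr
      rw [← Nat.descFactorial_eq_factorial_mul_choose]
      exact Nat.pow_sub_le_descFactorial x m
    _ = _ := by ring

/-- The structure theorem. Up to few exceptional edges, an `r`-graph without the blowup of a tree
consists of edges that meet a set `W` of bounded size in one vertex, together with (only if `b = 1`)
a family `S` of edges off `W` in which every `(r - 1)`-set lies in boundedly many edges. -/
theorem exists_structure {r s t a b : ℕ} (hr : 3 ≤ r) (hab : a + b = r) (hb : 1 ≤ b)
    (hba : b < a) (hs : 0 < s) {T : SimpleGraph (Fin s ⊕ Fin t)} (hT : T.IsTree)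
    (hbip : T ≤ completeBipartiteGraph (Fin s) (Fin t)) {η : ℝ} (hη : 0 < η) :
    ∃ w p K n₀ : ℕ, ∀ n ≥ n₀, ∀ H : Finset (Finset (Fin n)), IsUniform r H →
      IsFree (blowup T a b) H → ∃ (W : Finset (Fin n)) (S : Finset (Finset (Fin n))),
      W.card ≤ w ∧ S ⊆ H ∧ (∀ E ∈ S, Disjoint E W) ∧ (b ≠ 1 → S = ∅) ∧
      (∀ D : Finset (Fin n), D.card = r - 1 → (S.filter fun E => D ⊆ E).card ≤ p) ∧
      ((H.filter fun E => (E ∩ W).card ≠ 1 ∧ E ∉ S).card : ℝ) ≤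
        η * (n : ℝ) ^ (r - 1) + K * (n : ℝ) ^ (r - 2) := by
  classical
  set k := s * a + t * b + 2 * r with hk
  obtain ⟨C, hC, hdec⟩ := exists_decomposition k (m := r) (by omega)
  have hCpos : (0 : ℝ) < C := by exact_mod_cast hC
  obtain ⟨C₁, hhom⟩ := exists_homogeneous k (m := r) (by omega)
  have hγpos : 0 < η / (2 * ((C₁ : ℝ) + 1)) := by positivity
  obtain ⟨p, hp⟩ := exists_pow_lt_of_lt_one hγpos
    (show 1 - 1 / (C : ℝ) < 1 by rw [sub_lt_self_iff]; positivity)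
  obtain ⟨L, hL⟩ := exists_nat_gt (2 * (p : ℝ) / η)
  have hLpos : 0 < L := by
    have : (0 : ℝ) < L := lt_of_le_of_lt (by positivity) hL
    exact_mod_cast this
  have hLη : (p : ℝ) / L ≤ η / 2 := by
    have hL' : (0 : ℝ) < L := by exact_mod_cast hLpos
    rw [div_lt_iff₀ hη] at hL
    rw [div_le_iff₀ hL']
    linarith
  set w₀ := (4 * L) ^ (r - 1) * (r - 1).factorial with hw₀
  refine ⟨p * w₀, p, (p * w₀) ^ 2 + p, 2 * L * (r - 1 + 1), fun n hn H hH hfree => ?_⟩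
  have hfree' : ∀ G ⊆ H, IsFree (blowup T a b) G := fun G hG ⟨φ, hφ⟩ =>
    hfree ⟨φ, fun e he => hG (hφ e he)⟩
  -- a crude bound for the number of edges
  have hHcard : (H.card : ℝ) ≤ C₁ * (n : ℝ) ^ (r - 1) := by
    obtain ⟨χ, J, G, hG, hGhom, hle⟩ := hhom (Fin n) H hH
    have h1 := (hGhom.structure hr hab hb hba hs hT hbip (by omega) (by omega)
      (hfree' G hG) 0).1
    have h2 : H.card ≤ C₁ * n ^ (r - 1) :=
      hle.trans (by gcongr; exact h1.trans (Nat.choose_le_pow _ _))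
    exact_mod_cast h2
  obtain ⟨𝒢, h𝒢card, h𝒢, hrest⟩ := hdec p (Fin n) H hH
  have hstr : ∀ G ∈ 𝒢, ∃ W : Finset (Fin n), ∃ S ⊆ G,
      W.card ≤ w₀ ∧
      (∀ E ∈ S, ∀ E' ∈ S, r - 1 ≤ (E ∩ E').card → E = E') ∧ (b ≠ 1 → S = ∅) ∧
      (G.filter fun E => Disjoint E W ∧ E ∉ S).card ≤ (n / L + 1) * n.choose (r - 2) := by
    intro G hG
    obtain ⟨hGH, χ, J, hGhom⟩ := h𝒢 G hG
    obtain ⟨-, W, S, hS, h1, h2, h3, h4⟩ := hGhom.structure hr hab hb hba hs hT hbip (by omega)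
      (by omega) (hfree' G hGH) (n / L)
    refine ⟨W, S, hS, ?_, h2, h3, h4⟩
    have hx : 0 < (n / L).choose (r - 1) := by
      refine Nat.choose_pos ?_
      rw [Nat.le_div_iff_mul_le hLpos]
      calc (r - 1) * L ≤ 2 * L * (r - 1 + 1) := by nlinarith
        _ ≤ n := hn
    exact Nat.le_of_mul_le_mul_right (h1.trans (choose_le_mul_choose_div hLpos hn)) hx
  choose! W S hSG hW hSown hSb hfew using hstr
  have hWcard : (𝒢.biUnion W).card ≤ p * w₀ :=
    (Finset.card_biUnion_le_card_mul _ _ w₀ hW).trans (by gcongr)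
  refine ⟨𝒢.biUnion W, (𝒢.biUnion S).filter fun E => Disjoint E (𝒢.biUnion W), hWcard, ?_,
    fun E hE => (Finset.mem_filter.1 hE).2, ?_, ?_, ?_⟩
  · exact (Finset.filter_subset _ _).trans
      (Finset.biUnion_subset.2 fun G hG => (hSG G hG).trans (h𝒢 G hG).1)
  · intro hb1
    refine Finset.filter_eq_empty_iff.2 fun E hE => ?_
    obtain ⟨G, hG, hE⟩ := Finset.mem_biUnion.1 hE
    simp [hSb G hG hb1] at hE
  · intro D hD
    have hsub : (((𝒢.biUnion S).filter fun E => Disjoint E (𝒢.biUnion W)).filter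
        fun E => D ⊆ E) ⊆ 𝒢.biUnion fun G => (S G).filter fun E => D ⊆ E := by
      intro E hE
      simp only [Finset.mem_filter, Finset.mem_biUnion] at hE ⊢
      obtain ⟨⟨⟨G, hG, hE⟩, -⟩, hDE⟩ := hE
      exact ⟨G, hG, hE, hDE⟩
    refine (Finset.card_le_card hsub).trans ((Finset.card_biUnion_le_card_mul _ _ 1
      fun G hG => ?_).trans (by omega))
    refine Finset.card_le_one.2 fun E hE E' hE' => ?_
    obtain ⟨hE, hDE⟩ := Finset.mem_filter.1 hE
    obtain ⟨hE', hDE'⟩ := Finset.mem_filter.1 hE'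
    exact hSown G hG E hE E' hE' (hD ▸ Finset.card_le_card (Finset.subset_inter hDE hDE'))
  · set W₀ := 𝒢.biUnion W
    have hsub : (H.filter fun E => (E ∩ W₀).card ≠ 1 ∧
        E ∉ (𝒢.biUnion S).filter fun E => Disjoint E W₀) ⊆
        (H.filter fun E => ∀ G' ∈ 𝒢, E ∉ G') ∪ ((H.filter fun E => 2 ≤ (E ∩ W₀).card) ∪
          𝒢.biUnion fun G => G.filter fun E => Disjoint E (W G) ∧ E ∉ S G) := by
      intro E hE
      obtain ⟨hEH, hE1, hES⟩ := Finset.mem_filter.1 hE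
      by_cases hG : ∀ G' ∈ 𝒢, E ∉ G'
      · exact Finset.mem_union_left _ (Finset.mem_filter.2 ⟨hEH, hG⟩)
      refine Finset.mem_union_right _ ?_
      push Not at hG
      obtain ⟨G, hG, hEG⟩ := hG
      by_cases h2 : 2 ≤ (E ∩ W₀).card
      · exact Finset.mem_union_left _ (Finset.mem_filter.2 ⟨hEH, h2⟩)
      have h0 : Disjoint E W₀ := by
        rw [Finset.disjoint_iff_inter_eq_empty, ← Finset.card_eq_zero]
        omega
      refine Finset.mem_union_right _ (Finset.mem_biUnion.2 ⟨G, hG, Finset.mem_filter.2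
        ⟨hEG, h0.mono_right (Finset.subset_biUnion_of_mem W hG), fun h => hES ?_⟩⟩)
      exact Finset.mem_filter.2 ⟨Finset.mem_biUnion.2 ⟨G, hG, h⟩, h0⟩
    have hc1 : ((H.filter fun E => ∀ G' ∈ 𝒢, E ∉ G').card : ℝ) ≤ η / 2 * (n : ℝ) ^ (r - 1) := by
      calc ((H.filter fun E => ∀ G' ∈ 𝒢, E ∉ G').card : ℝ)
          ≤ (1 - 1 / (C : ℝ)) ^ p * H.card := hrest
        _ ≤ η / (2 * ((C₁ : ℝ) + 1)) * (((C₁ : ℝ) + 1) * (n : ℝ) ^ (r - 1)) := by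
          refine mul_le_mul hp.le (hHcard.trans ?_) (by positivity) hγpos.le
          gcongr
          linarith
        _ = _ := by field_simp
    have hc2 : ((H.filter fun E => 2 ≤ (E ∩ W₀).card).card : ℝ) ≤
        ((p * w₀) ^ 2 : ℕ) * (n : ℝ) ^ (r - 2) := by
      have := (card_filter_two_le (by omega) H hH W₀).trans
        (Nat.mul_le_mul_right _ (Nat.pow_le_pow_left hWcard 2))
      exact_mod_cast this
    have hc3 : ((𝒢.biUnion fun G => G.filter fun E => Disjoint E (W G) ∧ E ∉ S G).card : ℝ) ≤
        η / 2 * (n : ℝ) ^ (r - 1) + p * (n : ℝ) ^ (r - 2) := by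
      have h1 : (𝒢.biUnion fun G => G.filter fun E => Disjoint E (W G) ∧ E ∉ S G).card ≤
          p * ((n / L + 1) * n ^ (r - 2)) :=
        (Finset.card_biUnion_le_card_mul _ _ _ hfew).trans
          (by gcongr; exact Nat.choose_le_pow _ _)
      have h2 : ((n / L : ℕ) : ℝ) ≤ (n : ℝ) / L := Nat.cast_div_le
      calc _ ≤ ((p * ((n / L + 1) * n ^ (r - 2)) : ℕ) : ℝ) := by exact_mod_cast h1
        _ = p * ((((n / L : ℕ) : ℝ) + 1) * (n : ℝ) ^ (r - 2)) := by push_cast; ring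
        _ ≤ p * (((n : ℝ) / L + 1) * (n : ℝ) ^ (r - 2)) := by gcongr
        _ = (p / L) * ((n : ℝ) ^ (r - 2) * n) + p * (n : ℝ) ^ (r - 2) := by ring
        _ = (p / L) * (n : ℝ) ^ (r - 1) + p * (n : ℝ) ^ (r - 2) := by
          rw [← pow_succ, show r - 2 + 1 = r - 1 by omega]
        _ ≤ _ := by gcongr
    have hcard := (Finset.card_le_card hsub).trans ((Finset.card_union_le _ _).trans
      (Nat.add_le_add_left (Finset.card_union_le _ _) _))
    calc _ ≤ (((H.filter fun E => ∀ G' ∈ 𝒢, E ∉ G').card +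
          ((H.filter fun E => 2 ≤ (E ∩ W₀).card).card +
          (𝒢.biUnion fun G => G.filter fun E => Disjoint E (W G) ∧ E ∉ S G).card) : ℕ) : ℝ) := by
          exact_mod_cast hcard
      _ ≤ η / 2 * (n : ℝ) ^ (r - 1) + (((p * w₀) ^ 2 : ℕ) * (n : ℝ) ^ (r - 2) +
          (η / 2 * (n : ℝ) ^ (r - 1) + p * (n : ℝ) ^ (r - 2))) := by
          push_cast at hc2 ⊢
          gcongr
      _ = _ := by push_cast; ring

/-! ### Edges meeting a small set in one vertex -/

/-- An `m`-graph with many edges contains the `(a, b)`-blowup of a tree, where `a + b = m` and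
`b = 0` is allowed. -/
theorem exists_blocks_of_card_lt {m s t a b : ℕ} (hm : 0 < m) (hab : a + b = m) (hs : 0 < s)
    {T : SimpleGraph (Fin s ⊕ Fin t)} (hT : T.IsTree)
    (hbip : T ≤ completeBipartiteGraph (Fin s) (Fin t)) :
    ∃ d : ℕ, ∀ (n : ℕ) (G : Finset (Finset (Fin n))), IsUniform m G →
      d * n.choose (m - 1) < G.card →
      ∃ (f : Fin s → Finset (Fin n)) (g : Fin t → Finset (Fin n)), (∀ i, (f i).card = a) ∧
        (∀ j, (g j).card = b) ∧
        (∀ i i', i ≠ i' → Disjoint (f i) (f i')) ∧ (∀ j j', j ≠ j' → Disjoint (g j) (g j')) ∧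
        (∀ i j, Disjoint (f i) (g j)) ∧
        (∀ i j, T.Adj (Sum.inl i) (Sum.inr j) → f i ∪ g j ∈ G) ∧
        (∀ i, ∃ E ∈ G, f i ⊆ E) ∧ ∀ j, ∃ E ∈ G, g j ⊆ E := by
  classical
  obtain ⟨d, hd⟩ := exists_homogeneous (s * a + t * b + 2 * m) hm
  refine ⟨d, fun n G hG hlt => ?_⟩
  obtain ⟨χ, J, G', hG', hJ, hle⟩ := hd (Fin n) G hG
  have hlt' : n.choose (m - 1) < G'.card :=
    lt_of_mul_lt_mul_left (hlt.trans_le hle) (Nat.zero_le _)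
  have hne : G'.Nonempty := Finset.card_pos.1 (by omega)
  obtain ⟨E₀, hE₀⟩ := hne
  have hinter : ∀ A ∈ J, ∀ B ∈ J, A ∩ B ∈ J := fun A hA B hB =>
    hJ.inter_mem_of_mem ⟨E₀, hE₀⟩ (by omega) hA hB
  have hsingle : ∀ y, {y}ᶜ ∈ J := by
    intro y
    by_contra hy
    have h := hJ.card_le_choose (eq_univ_of_compl_singleton_subset hy)
    rw [Finset.card_compl, Finset.card_singleton, Fintype.card_fin, Fintype.card_fin] at h
    omega
  have hall : ∀ A, A ∈ J := by
    intro A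
    refine mem_of_forall_compl_singleton_mem ?_ hinter fun i _ => hsingle i
    have h := hJ.inter_mem E₀ hE₀ E₀ hE₀
    rwa [Finset.inter_self, show E₀.image χ = Finset.univ from
      Finset.eq_univ_iff_forall.2 fun i => by
        obtain ⟨v, hv, rfl⟩ := (hJ.rainbow E₀ hE₀).surjOn (Set.mem_univ i)
        exact Finset.mem_image_of_mem _ hv] at h
  obtain ⟨A, -, hA⟩ := Finset.exists_subset_card_eq (s := (Finset.univ : Finset (Fin m)))
    (n := a) (by simp; omega)
  obtain ⟨f, g, h1, h2, h3, h4, h5, h6, h7, h8⟩ := hJ.exists_blocks hT hbip hs ⟨E₀, hE₀⟩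
    (by omega) (hall A) (hall Aᶜ) (by simp) disjoint_compl_right hA
    (b := b) (by rw [Finset.card_compl, Fintype.card_fin]; omega)
  refine ⟨f, g, h1, h2, h3, h4, h5, fun i j hij => hG' (h6 i j hij), fun i => ?_, fun j => ?_⟩
  · obtain ⟨E, hE, h⟩ := h7 i
    exact ⟨E, hG' hE, h⟩
  · obtain ⟨E, hE, h⟩ := h8 j
    exact ⟨E, hG' hE, h⟩

/-- If `H` contains no blowup of the tree, few edges meet a given bounded set `W` in exactly one
vertex. By pigeonhole, more edges would yield `t` vertices of `W` with a dense common link, and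
a blowup of the tree inside that link extends to one in `H`. -/
theorem exists_card_filter_one_le {r s t a b : ℕ} (hr : 3 ≤ r) (hab : a + b = r) (hb : 1 ≤ b)
    (hs : 0 < s) (ht : 0 < t) {T : SimpleGraph (Fin s ⊕ Fin t)} (hT : T.IsTree)
    (hbip : T ≤ completeBipartiteGraph (Fin s) (Fin t)) (w : ℕ) :
    ∃ K : ℕ, ∀ (n : ℕ) (H : Finset (Finset (Fin n))), IsUniform r H → IsFree (blowup T a b) H →
      ∀ W : Finset (Fin n), W.card ≤ w →
      (H.filter fun E => (E ∩ W).card = 1).card ≤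
        (t - 1) * n.choose (r - 1) + K * n ^ (r - 2) := by
  classical
  obtain ⟨d, hd⟩ := exists_blocks_of_card_lt (m := r - 1) (a := a) (b := b - 1) (by omega)
    (by omega) hs hT hbip
  refine ⟨w * (2 ^ w * d), fun n H hH hfree W hW => ?_⟩
  let 𝓕 : Finset (Finset (Fin n)) := Finset.powersetCard (r - 1) Wᶜ
  have h𝓕 : ∀ F ∈ 𝓕, F ⊆ Wᶜ ∧ F.card = r - 1 := fun F hF => Finset.mem_powersetCard.1 hF
  let N : Finset (Fin n) → Finset (Fin n) := fun F => W.filter fun y => insert y F ∈ H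
  -- the common link of a `t`-subset of `W` is sparse
  have hlink : ∀ Y ∈ Finset.powersetCard t W,
      (𝓕.filter fun F => Y ⊆ N F).card ≤ d * n ^ (r - 2) := by
    intro Y hY
    obtain ⟨hYW, hYc⟩ := Finset.mem_powersetCard.1 hY
    by_contra! hlt
    obtain ⟨f, g, h1, h2, h3, h4, h5, h6, h7, h8⟩ := hd n (𝓕.filter fun F => Y ⊆ N F)
      (fun F hF => (h𝓕 F (Finset.filter_subset _ _ hF)).2)
      (lt_of_le_of_lt (by rw [Nat.sub_sub]; gcongr; exact Nat.choose_le_pow _ _) hlt)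
    let e : Fin t ≃ Y := (Finset.equivFinOfCardEq hYc).symm
    have hoff : ∀ X : Finset (Fin n), (∃ E ∈ 𝓕.filter fun F => Y ⊆ N F, X ⊆ E) →
        ∀ y ∈ W, y ∉ X := by
      rintro X ⟨E, hE, hXE⟩ y hy hyX
      exact Finset.mem_compl.1 ((h𝓕 E (Finset.filter_subset _ _ hE)).1 (hXE hyX)) hy
    have heW : ∀ j, (e j : Fin n) ∈ W := fun j => hYW (e j).2
    refine hfree (containsCopy_of_blocks f (fun j => insert (e j : Fin n) (g j)) h1 ?_ h3 ?_ ?_ ?_)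
    · intro j
      rw [Finset.card_insert_of_notMem (hoff _ (h8 j) _ (heW j)), h2]
      omega
    · intro j j' hne
      rw [Finset.disjoint_insert_left, Finset.disjoint_insert_right, Finset.mem_insert]
      refine ⟨?_, hoff _ (h8 j) _ (heW j'), h4 j j' hne⟩
      rintro (h | h)
      · exact hne (e.injective (Subtype.ext h))
      · exact hoff _ (h8 j') _ (heW j) h
    · intro i j
      rw [Finset.disjoint_insert_right]
      exact ⟨hoff _ (h7 i) _ (heW j), h5 i j⟩
    · intro i j hij
      have hmem := (Finset.mem_filter.1 (h6 i j hij)).2 (e j).2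
      rw [Finset.union_insert]
      exact (Finset.mem_filter.1 hmem).2
  have hmany : (𝓕.filter fun F => t ≤ (N F).card).card ≤ 2 ^ w * (d * n ^ (r - 2)) := by
    have hsub : (𝓕.filter fun F => t ≤ (N F).card) ⊆
        (Finset.powersetCard t W).biUnion fun Y => 𝓕.filter fun F => Y ⊆ N F := by
      intro F hF
      obtain ⟨hF, hFt⟩ := Finset.mem_filter.1 hF
      obtain ⟨Y, hY, hYc⟩ := Finset.exists_subset_card_eq hFt
      exact Finset.mem_biUnion.2 ⟨Y, Finset.mem_powersetCard.2
        ⟨hY.trans (Finset.filter_subset _ _), hYc⟩, Finset.mem_filter.2 ⟨hF, hY⟩⟩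
    refine (Finset.card_le_card hsub).trans ((Finset.card_biUnion_le_card_mul _ _ _ hlink).trans ?_)
    gcongr
    rw [Finset.card_powersetCard]
    exact (Nat.choose_le_two_pow _ _).trans (Nat.pow_le_pow_right (by omega) hW)
  have hcount : (H.filter fun E => (E ∩ W).card = 1).card ≤ ∑ F ∈ 𝓕, (N F).card := by
    have hsub : (H.filter fun E => (E ∩ W).card = 1) ⊆
        𝓕.biUnion fun F => (N F).image fun y => insert y F := by
      intro E hE
      obtain ⟨hEH, hE1⟩ := Finset.mem_filter.1 hE
      obtain ⟨y, hy⟩ := Finset.card_eq_one.1 hE1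
      have hyEW : y ∈ E ∩ W := hy ▸ Finset.mem_singleton_self y
      obtain ⟨hyE, hyW⟩ := Finset.mem_inter.1 hyEW
      refine Finset.mem_biUnion.2 ⟨E.erase y, Finset.mem_powersetCard.2 ⟨?_, ?_⟩,
        Finset.mem_image.2 ⟨y, Finset.mem_filter.2 ⟨hyW, ?_⟩, Finset.insert_erase hyE⟩⟩
      · intro v hv
        obtain ⟨hvy, hvE⟩ := Finset.mem_erase.1 hv
        refine Finset.mem_compl.2 fun hvW => hvy ?_
        have : v ∈ E ∩ W := Finset.mem_inter.2 ⟨hvE, hvW⟩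
        rwa [hy, Finset.mem_singleton] at this
      · rw [Finset.card_erase_of_mem hyE, hH E hEH]
      · rwa [Finset.insert_erase hyE]
    exact (Finset.card_le_card hsub).trans (Finset.card_biUnion_le.trans
      (Finset.sum_le_sum fun F _ => Finset.card_image_le))
  calc _ ≤ ∑ F ∈ 𝓕, (N F).card := hcount
    _ ≤ ∑ F ∈ 𝓕, ((t - 1) + if t ≤ (N F).card then w else 0) := by
      refine Finset.sum_le_sum fun F _ => ?_
      split_ifs with h
      · have : (N F).card ≤ w := (Finset.card_le_card (Finset.filter_subset _ _)).trans hW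
        omega
      · omega
    _ = 𝓕.card * (t - 1) + (𝓕.filter fun F => t ≤ (N F).card).card * w := by
      rw [Finset.sum_add_distrib, Finset.sum_const, smul_eq_mul, ← Finset.sum_filter,
        Finset.sum_const, smul_eq_mul]
    _ ≤ n.choose (r - 1) * (t - 1) + 2 ^ w * (d * n ^ (r - 2)) * w := by
      gcongr
      have := Finset.card_le_card (Finset.powersetCard_mono (n := r - 1) (Finset.subset_univ Wᶜ))
      simpa [𝓕] using this
    _ = _ := by ring

/-! ### Blowups with `b = 1` -/

/-- If a set is larger than the sum of prescribed thresholds over all fibres of two maps, some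
nonempty subset has all its fibres above their thresholds. -/
theorem exists_fibers_gt {ι κ κ' : Type*} [DecidableEq κ] [DecidableEq κ']
    (f : ι → κ) (g : ι → κ') (θ : κ → ℕ) (θ' : κ' → ℕ) (S : Finset ι)
    (h : ∑ x ∈ S.image f, θ x + ∑ x ∈ S.image g, θ' x < S.card) :
    ∃ S' ⊆ S, S'.Nonempty ∧ (∀ e ∈ S', θ (f e) < (S'.filter fun e' => f e' = f e).card) ∧
      ∀ e ∈ S', θ' (g e) < (S'.filter fun e' => g e' = g e).card := by
  classical
  induction hn : S.card using Nat.strong_induction_on generalizing S with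
  | _ n ih =>
    have remove : ∀ e ∈ S, ∀ (P : ι → Prop) [DecidablePred P], P e →
        (∑ x ∈ (S.filter fun e' => ¬ P e').image f, θ x +
          ∑ x ∈ (S.filter fun e' => ¬ P e').image g, θ' x + (S.filter P).card ≤
          ∑ x ∈ S.image f, θ x + ∑ x ∈ S.image g, θ' x) →
        ∃ S' ⊆ S, S'.Nonempty ∧ (∀ e ∈ S', θ (f e) < (S'.filter fun e' => f e' = f e).card) ∧
          ∀ e ∈ S', θ' (g e) < (S'.filter fun e' => g e' = g e).card := by
      intro e he P _ hPe hle
      have hsplit := Finset.card_filter_add_card_filter_not (s := S) P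
      have hpos : 0 < (S.filter P).card :=
        Finset.card_pos.2 ⟨e, Finset.mem_filter.2 ⟨he, hPe⟩⟩
      obtain ⟨S', hS', h'⟩ := ih (S.filter fun e' => ¬ P e').card (by omega)
        (S.filter fun e' => ¬ P e') (by omega) rfl
      exact ⟨S', hS'.trans (Finset.filter_subset _ _), h'⟩
    by_cases h1 : ∀ e ∈ S, θ (f e) < (S.filter fun e' => f e' = f e).card
    · by_cases h2 : ∀ e ∈ S, θ' (g e) < (S.filter fun e' => g e' = g e).card
      · exact ⟨S, subset_rfl, Finset.card_pos.1 (by omega), h1, h2⟩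
      · push Not at h2
        obtain ⟨e, he, hle⟩ := h2
        refine remove e he (fun e' => g e' = g e) rfl ?_
        have hA : ∑ x ∈ (S.filter fun e' => ¬ g e' = g e).image f, θ x ≤
            ∑ x ∈ S.image f, θ x :=
          Finset.sum_le_sum_of_subset (Finset.image_subset_image (Finset.filter_subset _ _))
        have hB : ∑ x ∈ (S.filter fun e' => ¬ g e' = g e).image g, θ' x ≤
            ∑ x ∈ (S.image g).erase (g e), θ' x := by
          refine Finset.sum_le_sum_of_subset fun x hx => ?_
          obtain ⟨e', he', rfl⟩ := Finset.mem_image.1 hx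
          obtain ⟨he', hne⟩ := Finset.mem_filter.1 he'
          exact Finset.mem_erase.2 ⟨hne, Finset.mem_image_of_mem _ he'⟩
        have hC := Finset.sum_erase_add (S.image g) θ' (Finset.mem_image_of_mem g he)
        omega
    · push Not at h1
      obtain ⟨e, he, hle⟩ := h1
      refine remove e he (fun e' => f e' = f e) rfl ?_
      have hA : ∑ x ∈ (S.filter fun e' => ¬ f e' = f e).image g, θ' x ≤
          ∑ x ∈ S.image g, θ' x :=
        Finset.sum_le_sum_of_subset (Finset.image_subset_image (Finset.filter_subset _ _))
      have hB : ∑ x ∈ (S.filter fun e' => ¬ f e' = f e).image f, θ x ≤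
          ∑ x ∈ (S.image f).erase (f e), θ x := by
        refine Finset.sum_le_sum_of_subset fun x hx => ?_
        obtain ⟨e', he', rfl⟩ := Finset.mem_image.1 hx
        obtain ⟨he', hne⟩ := Finset.mem_filter.1 he'
        exact Finset.mem_erase.2 ⟨hne, Finset.mem_image_of_mem _ he'⟩
      have hC := Finset.sum_erase_add (S.image f) θ (Finset.mem_image_of_mem f he)
      omega

/-- Suppose that every edge of `𝒩` meets `Z` in one vertex. If `𝒩` is larger than `t - 1` times the
number of `(r - 1)`-sets off `Z`, up to an error controlled by the codegrees between `Z` and its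
complement, then the `(r - 1, 1)`-blowup of the tree embeds with all blocks `V_j` inside `Z` and all
blocks `U_i` off `Z`. -/
theorem card_le_of_card_inter_eq_one {n r s t : ℕ} (hs : 0 < s) (ht : 0 < t)
    {T : SimpleGraph (Fin s ⊕ Fin t)} (hT : T.IsTree)
    (hbip : T ≤ completeBipartiteGraph (Fin s) (Fin t)) (𝒩 : Finset (Finset (Fin n)))
    (hu : IsUniform r 𝒩) (hfree : IsFree (blowup T (r - 1) 1) 𝒩) (Z : Finset (Fin n))
    (hZ : ∀ E ∈ 𝒩, (E ∩ Z).card = 1) (c : Fin n → ℕ)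
    (hc : ∀ y ∈ Z, ∀ x ∉ Z, (𝒩.filter fun E => y ∈ E ∧ x ∈ E).card ≤ c y) :
    𝒩.card ≤ (t - 1) * (Finset.powersetCard (r - 1) Zᶜ).card +
      ∑ y : Fin n, s * (r - 1) * c y := by
  classical
  by_contra! hlt
  have hcompl : ∀ E ∈ 𝒩, E \ Z ∈ Finset.powersetCard (r - 1) Zᶜ := by
    intro E hE
    refine Finset.mem_powersetCard.2 ⟨fun v hv => Finset.mem_compl.2 (Finset.mem_sdiff.1 hv).2, ?_⟩
    have := Finset.card_sdiff_add_card_inter E Z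
    rw [hZ E hE, hu E hE] at this
    omega
  let θ' : Finset (Fin n) → ℕ := fun B => ∑ y ∈ B, s * (r - 1) * c y
  have hsing : ∀ E ∈ 𝒩, ∃ y ∈ Z, E ∩ Z = {y} := by
    intro E hE
    obtain ⟨y, hy⟩ := Finset.card_eq_one.1 (hZ E hE)
    exact ⟨y, (Finset.mem_inter.1 (hy ▸ Finset.mem_singleton_self y : y ∈ E ∩ Z)).2, hy⟩
  obtain ⟨𝒩', hsub, ⟨E₀, hE₀⟩, hfib, hfib'⟩ := exists_fibers_gt (fun E => E \ Z)
    (fun E => E ∩ Z) (fun _ => t - 1) θ' 𝒩 (by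
      refine lt_of_le_of_lt (add_le_add ?_ ?_) hlt
      · rw [Finset.sum_const, smul_eq_mul, mul_comm]
        gcongr
        intro F hF
        obtain ⟨E, hE, rfl⟩ := Finset.mem_image.1 hF
        exact hcompl E hE
      · have : 𝒩.image (fun E => E ∩ Z) ⊆ Finset.univ.image fun y : Fin n => {y} := by
          intro B hB
          obtain ⟨E, hE, rfl⟩ := Finset.mem_image.1 hB
          obtain ⟨y, -, hy⟩ := hsing E hE
          exact Finset.mem_image.2 ⟨y, Finset.mem_univ _, hy.symm⟩
        refine (Finset.sum_le_sum_of_subset this).trans ?_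
        rw [Finset.sum_image fun x _ y _ h => Finset.singleton_injective h]
        simp [θ'])
  obtain ⟨f, g, hf, hg, h3, h4, h5, h6⟩ := exists_blocks hT hbip hs
    {A | ∃ E ∈ 𝒩', A = E \ Z} {B | ∃ E ∈ 𝒩', B = E ∩ Z} (fun A B => A ∪ B ∈ 𝒩')
    ⟨_, E₀, hE₀, rfl⟩
    (by
      rintro _ ⟨E, hE, rfl⟩ 𝒰 𝒱 hU hV - hcV
      -- at least `t` edges contain the block, and at most `t - 1` of them are excluded
      have hinj : ((𝒩'.filter fun E' => E' \ Z = E \ Z).image fun E' => E' ∩ Z).card =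
          (𝒩'.filter fun E' => E' \ Z = E \ Z).card := by
        refine Finset.card_image_of_injOn fun E₁ h₁ E₂ h₂ h => ?_
        rw [← Finset.sdiff_union_inter E₁ Z, ← Finset.sdiff_union_inter E₂ Z,
          (Finset.mem_filter.1 h₁).2, (Finset.mem_filter.1 h₂).2]
        exact congrArg _ h
      have hgt := hfib E hE
      obtain ⟨B, hB, hBV⟩ := Finset.exists_mem_notMem_of_card_lt_card
        (s := 𝒱) (t := (𝒩'.filter fun E' => E' \ Z = E \ Z).image fun E' => E' ∩ Z)
        (by rw [hinj]; omega)
      obtain ⟨E', hE', rfl⟩ := Finset.mem_image.1 hB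
      obtain ⟨hE'N, hE'eq⟩ := Finset.mem_filter.1 hE'
      refine ⟨_, ⟨E', hE'N, rfl⟩, ?_, ?_, ?_⟩
      · rwa [← hE'eq, Finset.sdiff_union_inter]
      · intro C hC
        obtain ⟨E₁, -, rfl⟩ := hU C hC
        exact Finset.sdiff_disjoint.mono_right Finset.inter_subset_right
      · intro C hC
        obtain ⟨E₁, hE₁, rfl⟩ := hV C hC
        obtain ⟨y, -, hy⟩ := hsing E' (hsub hE'N)
        obtain ⟨y₁, -, hy₁⟩ := hsing E₁ (hsub hE₁)
        rw [hy] at hBV ⊢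
        rw [hy₁] at hC ⊢
        rw [Finset.disjoint_singleton]
        rintro rfl
        exact hBV hC)
    (by
      rintro _ ⟨E, hE, rfl⟩ 𝒰 𝒱 hU hV hcU -
      obtain ⟨y, hyZ, hy⟩ := hsing E (hsub hE)
      have hgt := hfib' E hE
      simp only [θ', hy, Finset.sum_singleton] at hgt
      have hUcard : (𝒰.biUnion id).card ≤ s * (r - 1) := by
        refine (Finset.card_biUnion_le_card_mul _ _ (r - 1) fun C hC => ?_).trans (by gcongr)
        obtain ⟨E₁, hE₁, rfl⟩ := hU C hC
        exact (Finset.mem_powersetCard.1 (hcompl _ (hsub hE₁))).2.le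
      -- few of the edges through `y` meet the blocks used before
      have hbad : ((𝒰.biUnion id).biUnion fun x =>
          𝒩.filter fun E' => y ∈ E' ∧ x ∈ E').card ≤ s * (r - 1) * c y := by
        refine (Finset.card_biUnion_le_card_mul _ _ (c y) fun x hx => ?_).trans (by gcongr)
        obtain ⟨C, hC, hxC⟩ := Finset.mem_biUnion.1 hx
        obtain ⟨E₁, -, rfl⟩ := hU C hC
        exact hc y hyZ x (Finset.mem_sdiff.1 hxC).2
      obtain ⟨E', hE', hE'bad⟩ := Finset.exists_mem_notMem_of_card_lt_card
        (hbad.trans_lt hgt)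
      obtain ⟨hE'N, hE'eq⟩ := Finset.mem_filter.1 hE'
      have hyE' : y ∈ E' := (Finset.mem_inter.1
        (hE'eq ▸ Finset.mem_singleton_self y : y ∈ E' ∩ Z)).1
      refine ⟨_, ⟨E', hE'N, rfl⟩, ?_, ?_, ?_⟩
      · rwa [hy, ← hE'eq, Finset.sdiff_union_inter]
      · intro C hC
        refine Finset.disjoint_left.2 fun x hxC hxE => hE'bad ?_
        exact Finset.mem_biUnion.2 ⟨x, Finset.mem_biUnion.2 ⟨C, hC, hxC⟩,
          Finset.mem_filter.2 ⟨hsub hE'N, hyE', (Finset.mem_sdiff.1 hxE).1⟩⟩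
      · intro C hC
        obtain ⟨E₁, -, rfl⟩ := hV C hC
        exact (Finset.sdiff_disjoint.mono_right Finset.inter_subset_right).symm)
  refine hfree (containsCopy_of_blocks f g ?_ ?_ h3 h4 h5 fun i j hij => hsub (h6 i j hij))
  · intro i
    obtain ⟨E, hE, h⟩ := hf i
    rw [h]
    exact (Finset.mem_powersetCard.1 (hcompl _ (hsub hE))).2
  · intro j
    obtain ⟨E, hE, h⟩ := hg j
    rw [h]
    exact hZ E (hsub hE)

theorem card_filter_forall_ne_zero {n r : ℕ} [NeZero r] (F : Finset (Fin n)) :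
    (Finset.univ.filter fun χ : Fin n → Fin r => ∀ v ∈ F, χ v ≠ 0).card =
      (r - 1) ^ F.card * r ^ (n - F.card) := by
  classical
  have heq : (Finset.univ.filter fun χ : Fin n → Fin r => ∀ v ∈ F, χ v ≠ 0) =
      Fintype.piFinset fun v => if v ∈ F then Finset.univ.erase 0 else Finset.univ := by
    ext χ
    simp only [Finset.mem_filter, Finset.mem_univ, true_and, Fintype.mem_piFinset]
    refine forall_congr' fun v => ?_
    by_cases h : v ∈ F <;> simp [h]
  have hcard : ∀ v, (if v ∈ F then Finset.univ.erase (0 : Fin r) else Finset.univ).card =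
      if v ∈ F then r - 1 else r := by
    intro v
    by_cases h : v ∈ F <;> simp [h]
  have hcompl : (Finset.univ.filter fun v => v ∉ F) = Fᶜ := by ext; simp
  rw [heq, Fintype.card_piFinset, Finset.prod_congr rfl fun v _ => hcard v, Finset.prod_ite,
    Finset.prod_const, Finset.prod_const, hcompl, Finset.card_compl, Fintype.card_fin]
  simp

/-- For a random colouring with `r` colours, an `r`-set contains exactly one vertex of colour `0` at
least as often as an `(r - 1)`-set contains none. -/
theorem le_card_filter_inter_eq_one {n r : ℕ} [NeZero r] (E : Finset (Fin n)) (hE : E.card = r) :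
    (r - 1) ^ (r - 1) * r ^ (n - (r - 1)) ≤
      (Finset.univ.filter fun χ : Fin n → Fin r =>
        (E ∩ Finset.univ.filter fun v => χ v = 0).card = 1).card := by
  classical
  let P : Fin n → Finset (Fin n → Fin r) := fun y =>
    Finset.univ.filter fun χ => χ y = 0 ∧ ∀ v ∈ E.erase y, χ v ≠ 0
  -- recolouring `y` shows that `χ y = 0` holds for one out of `r` colourings
  have hP : ∀ y ∈ E, (r - 1) ^ (r - 1) * r ^ (n - (r - 1)) ≤ (P y).card * r := by
    intro y hy
    have hc : (E.erase y).card = r - 1 := by rw [Finset.card_erase_of_mem hy, hE]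
    have h := card_filter_forall_ne_zero (r := r) (E.erase y)
    rw [hc] at h
    rw [← h]
    calc _ ≤ (P y ×ˢ (Finset.univ : Finset (Fin r))).card := by
          refine Finset.card_le_card_of_injOn (fun χ => (Function.update χ y 0, χ y)) ?_ ?_
          · intro χ hχ
            have hχ' := (Finset.mem_filter.1 hχ).2
            refine Finset.mem_coe.2 (Finset.mem_product.2 ⟨Finset.mem_filter.2
              ⟨Finset.mem_univ _, by simp, fun v hv => ?_⟩, Finset.mem_univ _⟩)
            have hvy := (Finset.mem_erase.1 hv).1
            simpa [hvy] using hχ' v hv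
          · intro χ _ χ' _ hχ
            obtain ⟨h1, h2⟩ := Prod.mk.inj hχ
            funext v
            rcases eq_or_ne v y with rfl | hv
            · exact h2
            · simpa [hv] using congrFun h1 v
      _ = (P y).card * r := by simp
  have hsub : E.biUnion P ⊆ Finset.univ.filter fun χ : Fin n → Fin r =>
      (E ∩ Finset.univ.filter fun v => χ v = 0).card = 1 := by
    intro χ hχ
    obtain ⟨y, hy, hχ⟩ := Finset.mem_biUnion.1 hχ
    obtain ⟨h0, hne⟩ := (Finset.mem_filter.1 hχ).2
    refine Finset.mem_filter.2 ⟨Finset.mem_univ _, Finset.card_eq_one.2 ⟨y, ?_⟩⟩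
    ext v
    simp only [Finset.mem_inter, Finset.mem_filter, Finset.mem_univ, true_and,
      Finset.mem_singleton]
    constructor
    · rintro ⟨hv, hv0⟩
      by_contra hvy
      exact hne v (Finset.mem_erase.2 ⟨hvy, hv⟩) hv0
    · rintro rfl
      exact ⟨hy, h0⟩
  refine le_trans ?_ (Finset.card_le_card hsub)
  rw [Finset.card_biUnion]
  · have hrpos : 0 < r := Nat.pos_of_ne_zero (NeZero.ne r)
    refine Nat.le_of_mul_le_mul_right ?_ hrpos
    calc (r - 1) ^ (r - 1) * r ^ (n - (r - 1)) * r
        = ∑ y ∈ E, (r - 1) ^ (r - 1) * r ^ (n - (r - 1)) := by simp [hE, mul_comm]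
      _ ≤ ∑ y ∈ E, (P y).card * r := Finset.sum_le_sum hP
      _ = _ := by rw [Finset.sum_mul]
  · intro y hy y' hy' hne
    refine Finset.disjoint_left.2 fun χ hχ hχ' => ?_
    exact (Finset.mem_filter.1 hχ').2.2 y (Finset.mem_erase.2 ⟨hne, hy⟩)
      (Finset.mem_filter.1 hχ).2.1

theorem card_filter_pair_le {n r : ℕ} (H : Finset (Finset (Fin n))) (hH : IsUniform r H)
    {x y : Fin n} (hxy : x ≠ y) :
    (H.filter fun E => y ∈ E ∧ x ∈ E).card ≤ n ^ (r - 2) := by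
  classical
  have h : (H.filter fun E => y ∈ E ∧ x ∈ E).card ≤
      (Finset.powersetCard (r - 2) (Finset.univ : Finset (Fin n))).card := by
    refine Finset.card_le_card_of_injOn (fun E => (E.erase y).erase x) ?_ ?_
    · intro E hE
      obtain ⟨hEH, hy, hx⟩ := Finset.mem_filter.1 hE
      refine Finset.mem_coe.2 (Finset.mem_powersetCard.2 ⟨Finset.subset_univ _, ?_⟩)
      rw [Finset.card_erase_of_mem (Finset.mem_erase.2 ⟨hxy, hx⟩), Finset.card_erase_of_mem hy,
        hH E hEH]
      rfl
    · intro E hE E' hE' h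
      obtain ⟨-, hy, hx⟩ := Finset.mem_filter.1 hE
      obtain ⟨-, hy', hx'⟩ := Finset.mem_filter.1 hE'
      have := congrArg (fun X => insert y (insert x X)) h
      simpa only [Finset.insert_erase (Finset.mem_erase.2 ⟨hxy, hx⟩), Finset.insert_erase hy,
        Finset.insert_erase (Finset.mem_erase.2 ⟨hxy, hx'⟩), Finset.insert_erase hy'] using this
  refine h.trans ?_
  simpa using Nat.choose_le_pow n (r - 2)

theorem card_filter_pair_le_of_codegree {n r p : ℕ} (hr : 3 ≤ r) (S : Finset (Finset (Fin n)))
    (hS : IsUniform r S)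
    (hp : ∀ D : Finset (Fin n), D.card = r - 1 → (S.filter fun E => D ⊆ E).card ≤ p)
    {x y : Fin n} (hxy : x ≠ y) :
    (S.filter fun E => y ∈ E ∧ x ∈ E).card ≤ n ^ (r - 3) * p := by
  classical
  have hsub : (S.filter fun E => y ∈ E ∧ x ∈ E) ⊆
      ((Finset.powersetCard (r - 3) (Finset.univ : Finset (Fin n))).filter
        fun D => (insert y (insert x D)).card = r - 1).biUnion
        fun D => S.filter fun E => insert y (insert x D) ⊆ E := by
    intro E hE
    obtain ⟨hES, hy, hx⟩ := Finset.mem_filter.1 hE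
    have hx' : x ∈ E.erase y := Finset.mem_erase.2 ⟨hxy, hx⟩
    obtain ⟨D, hD, hDc⟩ := Finset.exists_subset_card_eq (s := (E.erase y).erase x) (n := r - 3) (by
      rw [Finset.card_erase_of_mem hx', Finset.card_erase_of_mem hy, hS E hES]
      omega)
    have hxD : x ∉ D := fun h => by simpa using hD h
    have hyD : y ∉ D := fun h => by simpa using hD h
    refine Finset.mem_biUnion.2 ⟨D, Finset.mem_filter.2 ⟨Finset.mem_powersetCard.2
      ⟨Finset.subset_univ _, hDc⟩, ?_⟩, Finset.mem_filter.2 ⟨hES, ?_⟩⟩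
    · rw [Finset.card_insert_of_notMem, Finset.card_insert_of_notMem hxD, hDc]
      · omega
      · rw [Finset.mem_insert]
        rintro (h | h)
        · exact hxy h.symm
        · exact hyD h
    · refine Finset.insert_subset hy (Finset.insert_subset hx (hD.trans ?_))
      exact (Finset.erase_subset _ _).trans (Finset.erase_subset _ _)
  refine (Finset.card_le_card hsub).trans ((Finset.card_biUnion_le_card_mul _ _ p
    fun D hD => hp _ (Finset.mem_filter.1 hD).2).trans ?_)
  gcongr
  refine (Finset.card_le_card (Finset.filter_subset _ _)).trans ?_
  simpa using Nat.choose_le_pow n (r - 3)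

/-- The bound for `b = 1`. The vertices are coloured randomly with `r` colours and `Z` consists of
`W` and of the vertices of colour `0`. The probability `1 / r` is chosen such that an edge meets `Z`
in one vertex at least as often as an `(r - 1)`-set is disjoint from `Z`. -/
theorem exists_card_union_le {r s t : ℕ} (hr : 3 ≤ r) (hs : 0 < s) (ht : 0 < t)
    {T : SimpleGraph (Fin s ⊕ Fin t)} (hT : T.IsTree)
    (hbip : T ≤ completeBipartiteGraph (Fin s) (Fin t)) (w p : ℕ) :
    ∃ K : ℕ, ∀ (n : ℕ) (H : Finset (Finset (Fin n))), IsUniform r H →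
      IsFree (blowup T (r - 1) 1) H → ∀ (W : Finset (Fin n)) (S : Finset (Finset (Fin n))),
      W.card ≤ w → S ⊆ H → (∀ E ∈ S, Disjoint E W) →
      (∀ D : Finset (Fin n), D.card = r - 1 → (S.filter fun E => D ⊆ E).card ≤ p) →
      (H.filter fun E => (E ∩ W).card = 1 ∨ E ∈ S).card ≤
        (t - 1) * n.choose (r - 1) + K * n ^ (r - 2) := by
  classical
  have : NeZero r := ⟨by omega⟩
  refine ⟨s * (r - 1) * (w + p) * r ^ (r - 1), fun n H hH hfree W S hW hS hSW hp => ?_⟩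
  set 𝓗 := H.filter fun E => (E ∩ W).card = 1 ∨ E ∈ S with h𝓗
  let Z : (Fin n → Fin r) → Finset (Fin n) := fun χ => W ∪ Finset.univ.filter fun v => χ v = 0
  let 𝒩 : (Fin n → Fin r) → Finset (Finset (Fin n)) := fun χ =>
    𝓗.filter fun E => (E ∩ Z χ).card = 1
  set N₀ := (r - 1) ^ (r - 1) * r ^ (n - (r - 1)) with hN₀
  set e := s * (r - 1) * (w + p) * n ^ (r - 2) with he
  have hupper : ∀ χ, (𝒩 χ).card ≤
      (t - 1) * (Finset.powersetCard (r - 1) (Z χ)ᶜ).card + e := by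
    intro χ
    have h𝒩H : 𝒩 χ ⊆ H := (Finset.filter_subset _ _).trans (Finset.filter_subset _ _)
    refine (card_le_of_card_inter_eq_one hs ht hT hbip (𝒩 χ) (fun E hE => hH E (h𝒩H hE))
      (fun ⟨φ, hφ⟩ => hfree ⟨φ, fun e he => h𝒩H (hφ e he)⟩) (Z χ)
      (fun E hE => (Finset.mem_filter.1 hE).2)
      (fun y => if y ∈ W then n ^ (r - 2) else n ^ (r - 3) * p) ?_).trans ?_
    · intro y hy x hx
      have hxy : x ≠ y := fun h => hx (h ▸ hy)
      split_ifs with hyW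
      · exact card_filter_pair_le _ (fun E hE => hH E (h𝒩H hE)) hxy
      · -- an edge through `y ∈ Z \ W` is disjoint from `W` and hence belongs to `S`
        refine le_trans (Finset.card_le_card ?_) (card_filter_pair_le_of_codegree hr S
          (fun E hE => hH E (hS hE)) hp hxy)
        intro E hE
        obtain ⟨hE𝒩, hyE, hxE⟩ := Finset.mem_filter.1 hE
        obtain ⟨hE𝓗, hE1⟩ := Finset.mem_filter.1 hE𝒩
        refine Finset.mem_filter.2 ⟨?_, hyE, hxE⟩
        refine (Finset.mem_filter.1 hE𝓗).2.resolve_left fun hW1 => hyW ?_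
        have hsub : E ∩ W ⊆ E ∩ Z χ :=
          Finset.inter_subset_inter_left Finset.subset_union_left
        have heq := Finset.eq_of_subset_of_card_le hsub (by rw [hE1, hW1])
        exact (Finset.mem_inter.1 (heq ▸ Finset.mem_inter.2 ⟨hyE, hy⟩ : y ∈ E ∩ W)).2
    · gcongr
      rw [← Finset.mul_sum, he, mul_assoc (s * (r - 1)) (w + p)]
      gcongr
      rw [Finset.sum_ite, Finset.sum_const, Finset.sum_const, smul_eq_mul, smul_eq_mul]
      have h1 : (Finset.univ.filter fun y => y ∈ W).card ≤ w := by simpa using hW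
      have h2 : (Finset.univ.filter fun y => y ∉ W).card ≤ n := by
        simpa using Finset.card_le_univ (Finset.univ.filter fun y => y ∉ W)
      calc _ ≤ w * n ^ (r - 2) + n * (n ^ (r - 3) * p) := by gcongr
        _ = w * n ^ (r - 2) + n ^ (r - 3 + 1) * p := by ring
        _ = _ := by
          rw [show r - 3 + 1 = r - 2 by omega]
          ring
  have hlower : 𝓗.card * N₀ ≤ ∑ χ, (𝒩 χ).card := by
    have hswap : ∑ χ, (𝒩 χ).card =
        ∑ E ∈ 𝓗, (Finset.univ.filter fun χ => (E ∩ Z χ).card = 1).card :=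
      (Finset.sum_card_bipartiteAbove_eq_sum_card_bipartiteBelow
        (fun (E : Finset (Fin n)) (χ : Fin n → Fin r) => (E ∩ Z χ).card = 1)
        (s := 𝓗) (t := Finset.univ)).symm
    rw [hswap, ← smul_eq_mul, ← Finset.sum_const]
    refine Finset.sum_le_sum fun E hE => ?_
    obtain ⟨hEH, hE'⟩ := Finset.mem_filter.1 hE
    by_cases hES : E ∈ S
    · have hEW : ∀ χ, E ∩ Z χ = E ∩ Finset.univ.filter fun v => χ v = 0 := by
        intro χ
        rw [Finset.inter_union_distrib_left, Finset.disjoint_iff_inter_eq_empty.1 (hSW E hES),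
          Finset.empty_union]
      simp only [hEW]
      exact le_card_filter_inter_eq_one E (hH E hEH)
    · obtain ⟨y, hy⟩ := Finset.card_eq_one.1 (hE'.resolve_right hES)
      have hyEW : y ∈ E ∩ W := hy ▸ Finset.mem_singleton_self y
      obtain ⟨hyE, hyW⟩ := Finset.mem_inter.1 hyEW
      have h := card_filter_forall_ne_zero (r := r) (E.erase y)
      rw [Finset.card_erase_of_mem hyE, hH E hEH] at h
      rw [hN₀, ← h]
      refine Finset.card_le_card fun χ hχ => ?_
      have hχ' := (Finset.mem_filter.1 hχ).2
      refine Finset.mem_filter.2 ⟨Finset.mem_univ _, Finset.card_eq_one.2 ⟨y, ?_⟩⟩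
      rw [Finset.inter_union_distrib_left, hy, Finset.union_eq_left]
      intro v hv
      obtain ⟨hvE, hv0⟩ := Finset.mem_inter.1 hv
      rw [Finset.mem_singleton]
      by_contra hvy
      exact hχ' v (Finset.mem_erase.2 ⟨hvy, hvE⟩) (Finset.mem_filter.1 hv0).2
  have hF : ∑ χ, (Finset.powersetCard (r - 1) (Z χ)ᶜ).card ≤ n.choose (r - 1) * N₀ := by
    have hswap : ∑ χ, (Finset.powersetCard (r - 1) (Z χ)ᶜ).card =
        ∑ F ∈ Finset.powersetCard (r - 1) (Finset.univ : Finset (Fin n)),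
          (Finset.univ.filter fun χ => F ⊆ (Z χ)ᶜ).card := by
      refine Eq.trans (Finset.sum_congr rfl fun χ _ => congrArg _ ?_)
        (Finset.sum_card_bipartiteAbove_eq_sum_card_bipartiteBelow
          (fun (χ : Fin n → Fin r) (F : Finset (Fin n)) => F ⊆ (Z χ)ᶜ)
          (s := Finset.univ) (t := Finset.powersetCard (r - 1) Finset.univ))
      ext F
      simp only [Finset.mem_powersetCard, Finset.bipartiteAbove, Finset.mem_filter,
        Finset.subset_univ, true_and]
      tauto
    rw [hswap]
    calc _ ≤ ∑ F ∈ Finset.powersetCard (r - 1) (Finset.univ : Finset (Fin n)), N₀ := by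
          refine Finset.sum_le_sum fun F hF => ?_
          have h := card_filter_forall_ne_zero (r := r) F
          rw [(Finset.mem_powersetCard.1 hF).2] at h
          rw [hN₀, ← h]
          refine Finset.card_le_card fun χ hχ => ?_
          refine Finset.mem_filter.2 ⟨Finset.mem_univ _, fun v hv hv0 => ?_⟩
          refine Finset.mem_compl.1 ((Finset.mem_filter.1 hχ).2 hv) ?_
          exact Finset.mem_union_right _ (Finset.mem_filter.2 ⟨Finset.mem_univ _, hv0⟩)
      _ = _ := by simp
  have hN₀pos : 0 < N₀ := by
    have h1 : 0 < r - 1 := by omega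
    have h2 : 0 < r := by omega
    positivity
  have hcolourings : Fintype.card (Fin n → Fin r) ≤ r ^ (r - 1) * N₀ := by
    rw [Fintype.card_fun, Fintype.card_fin, Fintype.card_fin]
    calc r ^ n ≤ r ^ (r - 1 + (n - (r - 1))) := Nat.pow_le_pow_right (by omega) (by omega)
      _ = r ^ (r - 1) * (1 * r ^ (n - (r - 1))) := by rw [pow_add, one_mul]
      _ ≤ _ := by
        rw [hN₀]
        gcongr
        exact Nat.one_le_pow _ _ (by omega)
  refine Nat.le_of_mul_le_mul_right ?_ hN₀pos
  calc 𝓗.card * N₀ ≤ ∑ χ, (𝒩 χ).card := hlower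
    _ ≤ ∑ χ, ((t - 1) * (Finset.powersetCard (r - 1) (Z χ)ᶜ).card + e) :=
      Finset.sum_le_sum fun χ _ => hupper χ
    _ = (t - 1) * ∑ χ, (Finset.powersetCard (r - 1) (Z χ)ᶜ).card +
        Fintype.card (Fin n → Fin r) * e := by
      rw [Finset.sum_add_distrib, ← Finset.mul_sum, Finset.sum_const, smul_eq_mul,
        Finset.card_univ]
    _ ≤ (t - 1) * (n.choose (r - 1) * N₀) + r ^ (r - 1) * N₀ * e := by gcongr
    _ = _ := by
      rw [he]
      ring

/-! ### The upper bound -/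

theorem eventually_card_le {r s t a b : ℕ} (hr : 3 ≤ r) (hs : 0 < s) (ht : 0 < t)
    (hab : a + b = r) (hb : 1 ≤ b) (hba : b < a) {T : SimpleGraph (Fin s ⊕ Fin t)} (hT : T.IsTree)
    (hbip : T ≤ completeBipartiteGraph (Fin s) (Fin t)) {ε : ℝ} (hε : 0 < ε) :
    ∃ n₀ : ℕ, ∀ n ≥ n₀, ∀ H : Finset (Finset (Fin n)), IsUniform r H →
      IsFree (blowup T a b) H →
      (H.card : ℝ) ≤ ((t : ℝ) - 1) * (n.choose (r - 1) : ℝ) + ε * (n : ℝ) ^ (r - 1) := by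
  classical
  obtain ⟨w, p, K, n₁, hstr⟩ := exists_structure hr hab hb hba hs hT hbip (half_pos hε)
  obtain ⟨K₁, hK₁⟩ := exists_card_filter_one_le hr hab hb hs ht hT hbip w
  obtain ⟨K₂, hK₂⟩ := exists_card_union_le hr hs ht hT hbip w p
  obtain ⟨n₂, hn₂⟩ := exists_nat_gt (2 * ((K : ℝ) + K₁ + K₂) / ε)
  refine ⟨max n₁ n₂, fun n hn H hH hfree => ?_⟩
  obtain ⟨W, S, hW, hS, hSW, hSb, hp, hErr⟩ := hstr n ((le_max_left _ _).trans hn) H hH hfree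
  have hmain : (H.filter fun E => (E ∩ W).card = 1 ∨ E ∈ S).card ≤
      (t - 1) * n.choose (r - 1) + (K₁ + K₂) * n ^ (r - 2) := by
    by_cases hb1 : b = 1
    · obtain rfl : a = r - 1 := by omega
      subst hb1
      refine (hK₂ n H hH hfree W S hW hS hSW hp).trans ?_
      gcongr
      omega
    · rw [hSb hb1]
      simp only [Finset.notMem_empty, or_false]
      refine (hK₁ n H hH hfree W hW).trans ?_
      gcongr
      omega
  have hsplit : H.card = (H.filter fun E => (E ∩ W).card = 1 ∨ E ∈ S).card +
      (H.filter fun E => (E ∩ W).card ≠ 1 ∧ E ∉ S).card := by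
    rw [← Finset.card_filter_add_card_filter_not (s := H) fun E => (E ∩ W).card = 1 ∨ E ∈ S]
    simp only [not_or, ne_eq]
  have hmain' : ((H.filter fun E => (E ∩ W).card = 1 ∨ E ∈ S).card : ℝ) ≤
      ((t : ℝ) - 1) * n.choose (r - 1) + ((K₁ : ℝ) + K₂) * (n : ℝ) ^ (r - 2) := by
    have h : ((t - 1 : ℕ) : ℝ) = (t : ℝ) - 1 := by
      rw [Nat.cast_sub ht, Nat.cast_one]
    rw [← h]
    exact_mod_cast hmain
  have hn' : 2 * ((K : ℝ) + K₁ + K₂) ≤ ε * n := by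
    rw [div_lt_iff₀ hε] at hn₂
    have : (n₂ : ℝ) ≤ n := by exact_mod_cast (le_max_right _ _).trans hn
    nlinarith
  have hpow : ((K : ℝ) + K₁ + K₂) * (n : ℝ) ^ (r - 2) ≤ ε / 2 * (n : ℝ) ^ (r - 1) := by
    rw [show r - 1 = r - 2 + 1 by omega, pow_succ]
    have : 0 ≤ (n : ℝ) ^ (r - 2) := by positivity
    nlinarith
  rw [hsplit, Nat.cast_add]
  linarith

/-! ### The crosscut construction -/

theorem isUniform_crosscutConstruction (c n r : ℕ) :
    IsUniform r (crosscutConstruction c n r) :=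
  fun _ hE => (Finset.mem_filter.1 hE).2.1

/-- A copy of the blowup of a tree in the crosscut construction has a crosscut among the first `c`
vertices. As the tree is connected, it contains a vertex of each `U_i` or a vertex of
each `V_j`. -/
theorem isFree_crosscutConstruction {s t a b c n r : ℕ} (hcs : c < s) (hct : c < t)
    {T : SimpleGraph (Fin s ⊕ Fin t)} (hT : T.Connected)
    (hbip : T ≤ completeBipartiteGraph (Fin s) (Fin t)) :
    IsFree (blowup T a b) (crosscutConstruction c n r) := by
  classical
  rintro ⟨φ, hφ⟩
  let block : Fin s ⊕ Fin t → Finset (BlowupVertex s t a b) :=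
    Sum.elim (fun i => blockU t b i) (fun j => blockV s a j)
  have hdisj : ∀ u v, u ≠ v → Disjoint (block u) (block v) := by
    rintro (i | j) (i' | j') hne <;> refine Finset.disjoint_left.2 fun x hx hx' => ?_ <;>
      simp only [block, Sum.elim_inl, Sum.elim_inr, blockU, blockV, Finset.mem_image,
        Finset.mem_univ, true_and] at hx hx' <;> obtain ⟨k, rfl⟩ := hx <;>
      obtain ⟨k', hk'⟩ := hx' <;> simp_all
  let cross : Fin s ⊕ Fin t → Finset (Fin n) := fun u =>
    ((block u).map φ).filter fun x => x.val < c
  have hcdisj : ∀ u v, u ≠ v → Disjoint (cross u) (cross v) := fun u v hne =>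
    Finset.disjoint_filter_filter (Finset.disjoint_map φ |>.2 (hdisj u v hne))
  have hadj : ∀ u v, T.Adj u v → (cross u).card + (cross v).card = 1 := by
    have key : ∀ i j, T.Adj (Sum.inl i) (Sum.inr j) →
        (cross (Sum.inl i)).card + (cross (Sum.inr j)).card = 1 := by
      intro i j hij
      have hmem : blockU t b i ∪ blockV s a j ∈ blowup T a b := by
        simp only [blowup, Finset.mem_filter, Finset.mem_univ, true_and]
        exact ⟨i, j, hij, rfl⟩
      have h := (Finset.mem_filter.1 (hφ _ hmem)).2.2
      rw [Finset.map_union, Finset.filter_union, Finset.card_union_of_disjoint] at h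
      · exact h
      · exact hcdisj (Sum.inl i) (Sum.inr j) (by simp)
    rintro (i | j) (i' | j') h
    · simpa using hbip h
    · exact key i j' h
    · rw [add_comm]
      exact key i' j h.symm
    · simpa using hbip h
  -- membership in one of the two parts decides whether a block meets the first `c` vertices
  have hpart : (∀ i, (cross (Sum.inl i)).card = 1) ∨ (∀ j, (cross (Sum.inr j)).card = 1) := by
    have hdich : ∀ u v, T.Reachable u v →
        ((cross u).card = if u.isLeft then 1 else 0) →
        ((cross v).card = if v.isLeft then 1 else 0) := by
      rintro u v ⟨w⟩
      induction w with
      | nil => exact id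
      | @cons x y z hxy _ ih =>
        intro hx
        refine ih ?_
        have h1 := hadj _ _ hxy
        have h2 := hbip hxy
        rcases x with i | j <;> rcases y with i' | j' <;> simp_all
    have hdich' : ∀ u v, T.Reachable u v →
        ((cross u).card = if u.isLeft then 0 else 1) →
        ((cross v).card = if v.isLeft then 0 else 1) := by
      rintro u v ⟨w⟩
      induction w with
      | nil => exact id
      | @cons x y z hxy _ ih =>
        intro hx
        refine ih ?_
        have h1 := hadj _ _ hxy
        have h2 := hbip hxy
        rcases x with i | j <;> rcases y with i' | j' <;> simp_all
    let i₀ : Fin s := ⟨0, by omega⟩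
    let j₀ : Fin t := ⟨0, by omega⟩
    have hle : (cross (Sum.inl i₀)).card ≤ 1 := by
      have hne : (Sum.inl i₀ : Fin s ⊕ Fin t) ≠ Sum.inr j₀ := by simp
      obtain ⟨w⟩ := hT.preconnected (Sum.inl i₀) (Sum.inr j₀)
      cases w with
      | cons h _ => exact le_of_le_of_eq (Nat.le_add_right _ _) (hadj _ _ h)
    rcases Nat.le_one_iff_eq_zero_or_eq_one.1 hle with h | h
    · right
      intro j
      simpa using hdich' _ _ (hT.preconnected (Sum.inl i₀) (Sum.inr j)) (by simpa using h)
    · left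
      intro i
      simpa using hdich _ _ (hT.preconnected (Sum.inl i₀) (Sum.inl i)) (by simpa using h)
  have hfirst : (Finset.univ.filter fun x : Fin n => x.val < c).card ≤ c := by
    have : ((Finset.univ.filter fun x : Fin n => x.val < c).image Fin.val).card ≤
        (Finset.range c).card := Finset.card_le_card fun x hx => by
      obtain ⟨y, hy, rfl⟩ := Finset.mem_image.1 hx
      exact Finset.mem_range.2 (Finset.mem_filter.1 hy).2
    rwa [Finset.card_image_of_injective _ Fin.val_injective, Finset.card_range] at this
  have hunion : ∀ {m : ℕ} (ι : Fin m → Fin s ⊕ Fin t), Function.Injective ι → c < m →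
      (∀ i, (cross (ι i)).card = 1) → False := by
    intro m ι hι hm h1
    have h2 : (Finset.univ.biUnion fun i => cross (ι i)).card = m := by
      rw [Finset.card_biUnion fun i _ j _ hne => hcdisj _ _ fun h => hne (hι h)]
      simp [h1]
    have h3 : (Finset.univ.biUnion fun i => cross (ι i)) ⊆
        Finset.univ.filter fun x : Fin n => x.val < c := by
      refine Finset.biUnion_subset.2 fun i _ x hx => ?_
      exact Finset.mem_filter.2 ⟨Finset.mem_univ _, (Finset.mem_filter.1 hx).2⟩
    have := (Finset.card_le_card h3).trans hfirst
    omega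
  rcases hpart with h | h
  · exact hunion Sum.inl Sum.inl_injective hcs h
  · exact hunion Sum.inr Sum.inr_injective hct h

theorem mul_choose_le_card_crosscutConstruction {c n r : ℕ} (hr : 0 < r) (hc : c ≤ n) :
    c * (n - c).choose (r - 1) ≤ (crosscutConstruction c n r).card := by
  classical
  let A : Finset (Fin n) := Finset.univ.filter fun x => x.val < c
  have hA : A.card = c := by
    have h := Fin.card_filter_val_lt (n := n) (m := c)
    rw [min_eq_right hc] at h
    exact h
  have hAc : Aᶜ.card = n - c := by rw [Finset.card_compl, Fintype.card_fin, hA]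
  have hcard : c * (n - c).choose (r - 1) =
      (A ×ˢ Finset.powersetCard (r - 1) Aᶜ).card := by
    rw [Finset.card_product, Finset.card_powersetCard, hA, hAc]
  rw [hcard]
  have hmem : ∀ x ∈ A ×ˢ Finset.powersetCard (r - 1) Aᶜ,
      (insert x.1 x.2).filter (fun v => v.val < c) = {x.1} ∧ x.1 ∉ x.2 ∧ x.2.card = r - 1 := by
    rintro ⟨y, F⟩ hx
    obtain ⟨hy, hF⟩ := Finset.mem_product.1 hx
    obtain ⟨hFA, hFc⟩ := Finset.mem_powersetCard.1 hF
    have hy' : y.val < c := (Finset.mem_filter.1 hy).2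
    refine ⟨?_, fun h => Finset.mem_compl.1 (hFA h) hy, hFc⟩
    rw [Finset.filter_insert, if_pos hy', Finset.filter_eq_empty_iff.2]
    · rfl
    · intro v hv hvc
      exact Finset.mem_compl.1 (hFA hv) (Finset.mem_filter.2 ⟨Finset.mem_univ _, hvc⟩)
  refine Finset.card_le_card_of_injOn (fun x => insert x.1 x.2) ?_ ?_
  · intro x hx
    obtain ⟨h1, h2, h3⟩ := hmem x hx
    refine Finset.mem_coe.2 (Finset.mem_filter.2 ⟨Finset.mem_univ _, ?_, ?_⟩)
    · simp only
      rw [Finset.card_insert_of_notMem h2, h3]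
      omega
    · simp only
      rw [h1, Finset.card_singleton]
  · intro x hx x' hx' h
    obtain ⟨h1, h2, -⟩ := hmem x hx
    obtain ⟨h1', h2', -⟩ := hmem x' hx'
    have h' : insert x.1 x.2 = insert x'.1 x'.2 := h
    rw [h', h1'] at h1
    have e1 : x.1 = x'.1 := (Finset.singleton_injective h1).symm
    refine Prod.ext e1 ?_
    rw [← Finset.erase_insert h2, ← Finset.erase_insert h2', h', e1]

theorem choose_le_choose_sub_add (n m c : ℕ) :
    n.choose (m + 1) ≤ (n - c).choose (m + 1) + c * n ^ m := by
  induction c with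
  | zero => simp
  | succ c ih =>
    refine ih.trans ?_
    rcases Nat.lt_or_ge c n with h | h
    · obtain ⟨l, hl⟩ : ∃ l, n - c = l + 1 := ⟨n - c - 1, by omega⟩
      rw [hl, show n - (c + 1) = l by omega, Nat.choose_succ_succ']
      have : l.choose m ≤ n ^ m := (Nat.choose_le_pow l m).trans (by gcongr; omega)
      linarith
    · rw [show n - c = n - (c + 1) by omega]
      gcongr
      omega

theorem le_card_crosscutConstruction {c n r : ℕ} (hr : 2 ≤ r) (hc : c ≤ n) :
    c * n.choose (r - 1) ≤ (crosscutConstruction c n r).card + c * (c * n ^ (r - 2)) := by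
  obtain ⟨m, rfl⟩ : ∃ m, r = m + 2 := ⟨r - 2, by omega⟩
  calc c * n.choose (m + 1) ≤ c * ((n - c).choose (m + 1) + c * n ^ m) := by
        gcongr
        exact choose_le_choose_sub_add n m c
    _ = c * (n - c).choose (m + 1) + c * (c * n ^ m) := mul_add _ _ _
    _ ≤ _ := Nat.add_le_add_right
      (mul_choose_le_card_crosscutConstruction (r := m + 2) (by omega) hc) _

/-! ### The Turán number -/

theorem card_le_ex {W : Type} {r n : ℕ} {F : Finset (Finset W)} {H : Finset (Finset (Fin n))}
    (hH : IsUniform r H) (hfree : IsFree F H) : H.card ≤ ex r n F := by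
  classical
  unfold ex
  exact Finset.le_sup (f := Finset.card) (Finset.mem_filter.2 ⟨Finset.mem_univ _, hH, hfree⟩)

theorem ex_le {W : Type} {r n : ℕ} {F : Finset (Finset W)} {x : ℝ} (hx : 0 ≤ x)
    (h : ∀ H : Finset (Finset (Fin n)), IsUniform r H → IsFree F H → (H.card : ℝ) ≤ x) :
    (ex r n F : ℝ) ≤ x := by
  classical
  refine (Nat.le_floor_iff hx).1 (Finset.sup_le fun H hH => ?_)
  obtain ⟨h1, h2⟩ := (Finset.mem_filter.1 hH).2
  exact Nat.le_floor (h H h1 h2)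

end HypergraphBlowup

theorem mainTheorem2 (r s t a b : ℕ) (hr : 3 ≤ r) (hs : 2 ≤ s) (ht : 2 ≤ t)
    (hab : a + b = r) (hba : b < a) (har : a < r)
    (T : SimpleGraph (Fin s ⊕ Fin t)) (hT : T.IsTree)
    (hbip : T ≤ completeBipartiteGraph (Fin s) (Fin t)) :
    -- the upper bound
    (∃ g : ℕ → ℝ, g =o[atTop] (fun n : ℕ => (n : ℝ) ^ (r - 1)) ∧
      ∀ (n : ℕ) (H : Finset (Finset (Fin n))),
        HypergraphBlowup.IsUniform r H →
        HypergraphBlowup.IsFree (HypergraphBlowup.blowup T a b) H →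
        (H.card : ℝ) ≤ ((t : ℝ) - 1) * (n.choose (r - 1) : ℝ) + g n) ∧
    -- asymptotic sharpness when `t ≤ s`, attained by the crosscut construction
    (t ≤ s →
      (fun n : ℕ => (HypergraphBlowup.ex r n (HypergraphBlowup.blowup T a b) : ℝ)
          - ((t : ℝ) - 1) * (n.choose (r - 1) : ℝ))
        =o[atTop] (fun n : ℕ => (n : ℝ) ^ (r - 1)) ∧
      (∀ n : ℕ,
        HypergraphBlowup.IsUniform r (HypergraphBlowup.crosscutConstruction (t - 1) n r) ∧
        HypergraphBlowup.IsFree (HypergraphBlowup.blowup T a b)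
          (HypergraphBlowup.crosscutConstruction (t - 1) n r)) ∧
      (fun n : ℕ => ((HypergraphBlowup.crosscutConstruction (t - 1) n r).card : ℝ)
          - ((t : ℝ) - 1) * (n.choose (r - 1) : ℝ))
        =o[atTop] (fun n : ℕ => (n : ℝ) ^ (r - 1))) := by
  have ht' : ((t - 1 : ℕ) : ℝ) = (t : ℝ) - 1 := by
    rw [Nat.cast_sub (by omega), Nat.cast_one]
  have htpos : (0 : ℝ) ≤ (t : ℝ) - 1 := ht' ▸ Nat.cast_nonneg _
  have hupper : ∀ ε : ℝ, 0 < ε → ∀ᶠ n : ℕ in atTop,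
      (HypergraphBlowup.ex r n (HypergraphBlowup.blowup T a b) : ℝ) ≤
        ((t : ℝ) - 1) * (n.choose (r - 1) : ℝ) + ε * (n : ℝ) ^ (r - 1) := by
    intro ε hε
    obtain ⟨n₀, hn₀⟩ := HypergraphBlowup.eventually_card_le hr (by omega) (by omega) hab
      (by omega) hba hT hbip hε
    filter_upwards [eventually_ge_atTop n₀] with n hn
    exact HypergraphBlowup.ex_le (by positivity) (hn₀ n hn)
  refine ⟨⟨fun n => max 0 ((HypergraphBlowup.ex r n (HypergraphBlowup.blowup T a b) : ℝ)
    - ((t : ℝ) - 1) * (n.choose (r - 1) : ℝ)), ?_, ?_⟩, fun hts => ?_⟩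
  · rw [isLittleO_iff]
    intro ε hε
    filter_upwards [hupper ε hε] with n hn
    have hpos : 0 ≤ (n : ℝ) ^ (r - 1) := by positivity
    rw [Real.norm_of_nonneg (le_max_left _ _), Real.norm_of_nonneg hpos]
    refine max_le (by positivity) ?_
    linarith
  · intro n H hH hfree
    have h1 : (H.card : ℝ) ≤ HypergraphBlowup.ex r n (HypergraphBlowup.blowup T a b) := by
      exact_mod_cast HypergraphBlowup.card_le_ex hH hfree
    have h2 := le_max_right 0 ((HypergraphBlowup.ex r n (HypergraphBlowup.blowup T a b) : ℝ)
      - ((t : ℝ) - 1) * (n.choose (r - 1) : ℝ))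
    linarith
  · have hcross : ∀ n : ℕ,
        HypergraphBlowup.IsUniform r (HypergraphBlowup.crosscutConstruction (t - 1) n r) ∧
        HypergraphBlowup.IsFree (HypergraphBlowup.blowup T a b)
          (HypergraphBlowup.crosscutConstruction (t - 1) n r) := fun n =>
      ⟨HypergraphBlowup.isUniform_crosscutConstruction _ _ _,
        HypergraphBlowup.isFree_crosscutConstruction (by omega) (by omega) hT.connected hbip⟩
    have hle : ∀ n : ℕ, ((HypergraphBlowup.crosscutConstruction (t - 1) n r).card : ℝ) ≤
        HypergraphBlowup.ex r n (HypergraphBlowup.blowup T a b) := fun n => by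
      exact_mod_cast HypergraphBlowup.card_le_ex (hcross n).1 (hcross n).2
    have hlower : ∀ ε : ℝ, 0 < ε → ∀ᶠ n : ℕ in atTop,
        ((t : ℝ) - 1) * (n.choose (r - 1) : ℝ) - ε * (n : ℝ) ^ (r - 1) ≤
          (HypergraphBlowup.crosscutConstruction (t - 1) n r).card := by
      intro ε hε
      obtain ⟨n₀, hn₀⟩ := exists_nat_gt (((t : ℝ) - 1) * ((t : ℝ) - 1) / ε)
      filter_upwards [eventually_ge_atTop n₀, eventually_ge_atTop (t - 1)] with n hn hnt
      have h1 : ((t : ℝ) - 1) * (n.choose (r - 1) : ℝ) ≤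
          (HypergraphBlowup.crosscutConstruction (t - 1) n r).card +
            ((t : ℝ) - 1) * (((t : ℝ) - 1) * (n : ℝ) ^ (r - 2)) := by
        rw [← ht']
        exact_mod_cast HypergraphBlowup.le_card_crosscutConstruction (by omega) hnt
      have h2 : ((t : ℝ) - 1) * ((t : ℝ) - 1) ≤ ε * n := by
        rw [div_lt_iff₀ hε] at hn₀
        have : (n₀ : ℝ) ≤ n := by exact_mod_cast hn
        nlinarith
      have h3 : ((t : ℝ) - 1) * (((t : ℝ) - 1) * (n : ℝ) ^ (r - 2)) ≤
          ε * (n : ℝ) ^ (r - 1) := by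
        rw [show r - 1 = r - 2 + 1 by omega, pow_succ, ← mul_assoc]
        have : 0 ≤ (n : ℝ) ^ (r - 2) := by positivity
        nlinarith
      linarith
    refine ⟨?_, hcross, ?_⟩
    all_goals
      rw [isLittleO_iff]
      intro ε hε
      filter_upwards [hupper ε hε, hlower ε hε] with n h1 h2
      have hpos : 0 ≤ (n : ℝ) ^ (r - 1) := by positivity
      rw [Real.norm_of_nonneg hpos, Real.norm_eq_abs, abs_le]
      have := hle n
      constructor <;> linarith
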